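/- Let $I$ be a non-empty countable (finite or infinite) index set and let $A=(A_{i,j})_{i,j\in I}$ and $B=(B_{i,j})_{i,j\in I}$ be integer matrices each of whose rows has only finitely many non-zero entries. Put $\Omega_A(i)=\{j\in I : A_{i,j}\ge 1\}$ and $\Omega_A=\{(i,j): j\in\Omega_A(i)\}$. Assume condition (0): all entries of $A$ are non-negative, $\Omega_A(i)\neq\emptyset$ for every $i\in I$, and $B_{i,j}=0$ whenever $(i,j)\notin\Omega_A$. Let $\mathcal T_{A,B}$ be the universal $C^*$-algebra generated by mutually orthogonal projections $p_i$ $(i\in I)$, partial unitaries $u_i$ with $u_i^*u_i=u_iu_i^*=p_i$ $(i\in I)$, and partial isometries $s_{i,j,n}$ $((i,j)\in\Omega_A,\ n\in\mathbb Z)$ subject to the relations 1. $s_{i,j,n}u_j=s_{i,j,n+A_{i,j}}$ and $u_is_{i,j,n}=s_{i,j,n+B_{i,j}}$ for all $(i,j)\in\Omega_A$, $n\in\mathbb Z$; 2. $s_{i,j,n}^*s_{i,j,n}=p_j$ for all $(i,j)\in\Omega_A$, $n\in\mathbb Z$; 3. $p_i\ge\sum_{j\in\Omega_A(i)}\sum_{n=1}^{A_{i,j}}s_{i,j,n}s_{i,j,n}^*$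 for all $i\in I$. Let $\mathcal O_{A,B}$ be the universal $C^*$-algebra defined in the same way but with equality in relation 3, and let $\mathcal J_{A,B}\subset\mathcal T_{A,B}$ be the kernel of the natural surjective $*$-homomorphism $\mathcal T_{A,B}\to\mathcal O_{A,B}$ which maps each generator to the generator of the same name. For $i\in I$ put $$u_i'=u_i-\sum_{j\in\Omega_A(i)}\sum_{n=1}^{A_{i,j}}s_{i,j,n+B_{i,j}}s_{i,j,n}^*\in\mathcal T_{A,B}.$$ **Proposition A.1 and its corollary.** The ideal $\mathcal J_{A,B}$ of $\mathcal T_{A,B}$ is essential, that is, it has non-zero intersection with every non-zero closed two-sided ideal of $\mathcal T_{A,B}$. Moreover, for every $C^*$-algebra $C$ (unital or not), a $*$-homomorphism $\varphi\colon\mathcal T_{A,B}\to C$ is injective if and only if for every $i\in I$ the spectrum of $\varphi(u_i')$ (computed in the unitization of $C$ if $C$ has no unit) contains the unit circle $\mathbb T=\{z\in\mathbb C:|z|=1\}$. -/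

import Mathlib

universe u v

noncomputable section

namespace UniversalCStar

variable {G : Type u}

/-- Non-commutative `*`-polynomials without constant term in the letters `g`, `g*` (`g ∈ G`),
with complex coefficients. The letter `Sum.inl g` stands for `g`, and `Sum.inr g` for `g*`. -/
abbrev Poly (G : Type u) : Type u := MonoidAlgebra ℂ (FreeSemigroup (G ⊕ G))

/-- Evaluation of `*`-polynomials at a family `f` of elements of a C*-algebra. -/
def eval {C : Type v} [NonUnitalCStarAlgebra C] (f : G → C) : Poly G →ₙₐ[ℂ] C :=
  MonoidAlgebra.liftMagma ℂ (FreeSemigroup.lift (Sum.elim f fun g => star (f g)))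

theorem eval_natural {C D : Type*} [NonUnitalCStarAlgebra C] [NonUnitalCStarAlgebra D]
    (φ : C →⋆ₙₐ[ℂ] D) (f : G → C) (P : Poly G) : φ (eval f P) = eval (fun g => φ (f g)) P := by
  have h : (φ : C →ₙₐ[ℂ] D).comp (eval f) = eval (fun g => φ (f g)) := by
    apply (MonoidAlgebra.liftMagma ℂ).symm.injective
    apply FreeSemigroup.lift.symm.injective
    funext x
    rcases x with g | g
    · simp [eval, MonoidAlgebra.liftMagma, FreeSemigroup.lift, FreeSemigroup.of]
      rfl
    · simp [eval, MonoidAlgebra.liftMagma, FreeSemigroup.lift, FreeSemigroup.of]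
      exact map_star φ (f g)
  exact DFunLike.congr_fun h P

theorem eval_inl {C : Type*} [NonUnitalCStarAlgebra C] (f : G → C) (g : G) :
    eval f (MonoidAlgebra.single (FreeSemigroup.of (Sum.inl g)) 1) = f g := by
  simp [eval, MonoidAlgebra.liftMagma, FreeSemigroup.lift, FreeSemigroup.of]

theorem eval_inr {C : Type*} [NonUnitalCStarAlgebra C] (f : G → C) (g : G) :
    eval f (MonoidAlgebra.single (FreeSemigroup.of (Sum.inr g)) 1) = star (f g) := by
  simp [eval, MonoidAlgebra.liftMagma, FreeSemigroup.lift, FreeSemigroup.of]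

theorem exists_eval_of_mem_adjoin {C : Type*} [NonUnitalCStarAlgebra C] (f : G → C) {x : C}
    (hx : x ∈ NonUnitalStarAlgebra.adjoin ℂ (Set.range f)) : ∃ P, eval f P = x := by
  have h : (NonUnitalStarAlgebra.adjoin ℂ (Set.range f)).toNonUnitalSubalgebra ≤
      NonUnitalAlgHom.range (eval f) := by
    rw [NonUnitalStarAlgebra.adjoin_toNonUnitalSubalgebra]
    refine NonUnitalAlgebra.adjoin_le ?_
    rintro y (⟨g, rfl⟩ | ⟨g, hg⟩)
    · exact ⟨_, eval_inl f g⟩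
    · refine ⟨MonoidAlgebra.single (FreeSemigroup.of (Sum.inr g)) 1, ?_⟩
      change eval f _ = y
      rw [eval_inr, hg, star_star]
  exact h hx

/-- The C*-subalgebra generated by a family. -/
def gensub {C : Type v} [NonUnitalCStarAlgebra C] (f : G → C) : NonUnitalStarSubalgebra ℂ C :=
  (NonUnitalStarAlgebra.adjoin ℂ (Set.range f)).topologicalClosure

theorem isClosed_gensub {C : Type v} [NonUnitalCStarAlgebra C] (f : G → C) :
    IsClosed (gensub f : Set C) :=
  NonUnitalStarSubalgebra.isClosed_topologicalClosure _

theorem mem_gensub {C : Type v} [NonUnitalCStarAlgebra C] (f : G → C) (g : G) :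
    f g ∈ gensub f :=
  NonUnitalStarSubalgebra.le_topologicalClosure _
    (NonUnitalStarAlgebra.subset_adjoin ℂ _ ⟨g, rfl⟩)

theorem gensub_le {C : Type v} [NonUnitalCStarAlgebra C] (f : G → C)
    {S : NonUnitalStarSubalgebra ℂ C} (hS : IsClosed (S : Set C)) (h : ∀ g, f g ∈ S) :
    gensub f ≤ S :=
  NonUnitalStarSubalgebra.topologicalClosure_minimal _
    (NonUnitalStarAlgebra.adjoin_le (by rintro _ ⟨g, rfl⟩; exact h g)) hS

theorem gensub_induction {C : Type v} [NonUnitalCStarAlgebra C] (f : G → C) {p : C → Prop}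
    (hc : IsClosed {x | p x}) (h : ∀ P, p (eval f P)) {x : C} (hx : x ∈ gensub f) : p x := by
  refine closure_minimal (s := (NonUnitalStarAlgebra.adjoin ℂ (Set.range f) : Set C)) ?_ hc hx
  intro y hy
  obtain ⟨P, rfl⟩ := exists_eval_of_mem_adjoin f hy
  exact h P

theorem continuous_hom {C D : Type*} [NonUnitalCStarAlgebra C] [NonUnitalCStarAlgebra D]
    (φ : C →⋆ₙₐ[ℂ] D) : Continuous φ :=
  (NonUnitalStarAlgHom.instContinuousLinearMapClassComplex (F := C →⋆ₙₐ[ℂ] D)).map_continuous φ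

/-- If `‖P(f')‖ ≤ ‖P(f)‖` for every `*`-polynomial `P`, there is a `*`-homomorphism from the
C*-algebra generated by `f` with `f g ↦ f' g`. -/
theorem exists_hom_of_norm_le {C D : Type*} [NonUnitalCStarAlgebra C] [NonUnitalCStarAlgebra D]
    (f : G → C) (f' : G → D) (h : ∀ P : Poly G, ‖eval f' P‖ ≤ ‖eval f P‖) :
    ∃ φ : gensub f →⋆ₙₐ[ℂ] D, ∀ g, φ ⟨f g, mem_gensub f g⟩ = f' g := by
  let F : G → C × D := fun g => (f g, f' g)
  let S := gensub F
  have : IsClosed (S : Set (C × D)) := isClosed_gensub F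
  have hfst : ∀ P, (eval F P).1 = eval f P := fun P =>
    eval_natural (NonUnitalStarAlgHom.fst ℂ C D) F P
  have hsnd : ∀ P, (eval F P).2 = eval f' P := fun P =>
    eval_natural (NonUnitalStarAlgHom.snd ℂ C D) F P
  have hnorm : ∀ x ∈ S, ‖x‖ = ‖x.1‖ := by
    intro x hx
    refine gensub_induction F (p := fun x => ‖x‖ = ‖x.1‖)
      (isClosed_eq continuous_norm (continuous_norm.comp continuous_fst)) ?_ hx
    intro P
    rw [Prod.norm_def, hfst, hsnd]
    exact max_eq_left (h P)
  have hmem : ∀ x ∈ S, x.1 ∈ gensub f := by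
    have : S ≤ (gensub f).comap (NonUnitalStarAlgHom.fst ℂ C D) := by
      refine gensub_le F ?_ fun g => ?_
      · exact (isClosed_gensub f).preimage continuous_fst
      · exact mem_gensub f g
    exact fun x hx => this hx
  let π : S →⋆ₙₐ[ℂ] gensub f :=
    NonUnitalStarAlgHom.codRestrict
      ((NonUnitalStarAlgHom.fst ℂ C D).comp (NonUnitalStarSubalgebraClass.subtype S))
      (gensub f) fun x => hmem x x.2
  have : IsClosed (gensub f : Set C) := isClosed_gensub f
  have hiso : ∀ x : S, ‖π x‖ = ‖x‖ := fun x => (hnorm x x.2).symm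
  have hisom : Isometry π := AddMonoidHomClass.isometry_of_norm π hiso
  have hsurj : Function.Surjective π := by
    have hcl : IsClosed (Set.range fun x : S => (x : C × D).1) :=
      (Isometry.isClosedEmbedding (f := fun x : S => (x : C × D).1)
        (show Isometry (Subtype.val ∘ π) from isometry_subtype_coe.comp hisom)).isClosed_range
    let ψ := (NonUnitalStarAlgHom.fst ℂ C D).comp (NonUnitalStarSubalgebraClass.subtype S)
    have hle : gensub f ≤ NonUnitalStarAlgHom.range ψ := by
      refine gensub_le f ?_ fun g => ⟨⟨F g, mem_gensub F g⟩, rfl⟩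
      exact hcl
    intro y
    obtain ⟨x, hx⟩ := hle y.2
    exact ⟨x, Subtype.ext hx⟩
  let e := StarAlgEquiv.ofBijective π ⟨hisom.injective, hsurj⟩
  refine ⟨((NonUnitalStarAlgHom.snd ℂ C D).comp (NonUnitalStarSubalgebraClass.subtype S)).comp
    (e.symm : gensub f →⋆ₙₐ[ℂ] S), fun g => ?_⟩
  have : e.symm ⟨f g, mem_gensub f g⟩ = ⟨F g, mem_gensub F g⟩ := by
    rw [StarAlgEquiv.symm_apply_eq]
    rfl
  change (e.symm ⟨f g, mem_gensub f g⟩ : C × D).2 = f' g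
  rw [this]

/-- The C*-algebra generated by a family indexed by a type in `Type u` has a model in `Type u`. -/
theorem exists_small_model {C : Type v} [NonUnitalCStarAlgebra C] (f : G → C) :
    ∃ (D : Type u) (_ : NonUnitalCStarAlgebra D) (f' : G → D) (j : D →⋆ₙₐ[ℂ] C),
      Function.Injective j ∧ ∀ g, j (f' g) = f g := by
  have hcl : IsClosed (gensub f : Set C) := isClosed_gensub f
  have : Small.{u} (gensub f) := by
    let lim : (ℕ → Poly G) → C := fun a =>
      @Filter.limUnder _ _ _ ⟨0⟩ Filter.atTop fun n => eval f (a n)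
    have hsub : (gensub f : Set C) ⊆ Set.range lim := by
      intro x hx
      obtain ⟨y, hy, hyx⟩ := mem_closure_iff_seq_limit.1 hx
      choose a ha using fun n => exists_eval_of_mem_adjoin f (hy n)
      refine ⟨a, ?_⟩
      simp only [lim, ha]
      exact hyx.limUnder_eq
    exact small_subset hsub
  let e : Shrink.{u} (gensub f) ≃ gensub f := (equivShrink (gensub f)).symm
  let i1 : NonUnitalRing (Shrink.{u} (gensub f)) := e.nonUnitalRing
  let i2 : Module ℂ (Shrink.{u} (gensub f)) := e.module ℂ
  let er : Shrink.{u} (gensub f) ≃+* gensub f := e.ringEquiv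
  have hsmul : ∀ (c : ℂ) x, er (c • x) = c • er x := fun c x => e.apply_symm_apply _
  let i3 : NonUnitalNormedRing (Shrink.{u} (gensub f)) :=
    NonUnitalNormedRing.induced _ (gensub f) er er.injective
  have hn : ∀ x, ‖er x‖ = ‖x‖ := fun x => rfl
  have hisom : Isometry er := AddMonoidHomClass.isometry_of_norm er hn
  let i4 : StarRing (Shrink.{u} (gensub f)) :=
    { star := fun x => er.symm (star (er x))
      star_involutive := fun x => by simp
      star_mul := fun x y => by simp
      star_add := fun x y => by simp }
  have hstar : ∀ x, er (star x) = star (er x) := fun x => er.apply_symm_apply _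
  let i5 : NonUnitalCStarAlgebra (Shrink.{u} (gensub f)) :=
    { i3, i4, i2 with
      complete := @fun F hF => by
        have : CompleteSpace (Shrink.{u} (gensub f)) :=
          (completeSpace_congr (e := er.toEquiv) hisom.isUniformEmbedding).2
            (inferInstance : CompleteSpace (gensub f))
        exact this.complete hF
      norm_mul_self_le := fun x => by
        rw [← hn, ← hn, map_mul, hstar]
        exact CStarRing.norm_mul_self_le (er x)
      norm_smul_le := fun c x => by
        rw [← hn, ← hn, hsmul, norm_smul]
      smul_assoc := fun c x y => er.injective (by
        simp only [smul_eq_mul, map_mul, hsmul, smul_mul_assoc])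
      smul_comm := fun c x y => er.injective (by
        simp only [smul_eq_mul, map_mul, hsmul, mul_smul_comm])
      star_smul := fun c x => er.injective (by
        simp only [hsmul, hstar, star_smul]) }
  let j : Shrink.{u} (gensub f) →⋆ₙₐ[ℂ] gensub f :=
    { toFun := er
      map_smul' := hsmul
      map_zero' := map_zero er
      map_add' := map_add er
      map_mul' := map_mul er
      map_star' := hstar }
  refine ⟨Shrink.{u} (gensub f), i5, fun g => er.symm ⟨f g, mem_gensub f g⟩,
    (NonUnitalStarSubalgebraClass.subtype (gensub f)).comp j, ?_, fun g => ?_⟩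
  · exact Subtype.val_injective.comp er.injective
  · change ((er (er.symm ⟨f g, mem_gensub f g⟩) : gensub f) : C) = f g
    rw [er.apply_symm_apply]

/-- A set of relations on a family of generators indexed by `G`: a condition on `G`-indexed
families in C*-algebras which forces the members of the family to be contractions. -/
structure Relations (G : Type u) where
  /-- the family `f` in `C` satisfies the relations -/
  Holds : ∀ (C : Type u) [NonUnitalCStarAlgebra C], (G → C) → Prop
  /-- the relations bound the norms of the generators -/
  norm_le_one : ∀ (C : Type u) [NonUnitalCStarAlgebra C] (f : G → C), Holds C f → ∀ g, ‖f g‖ ≤ 1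

variable (R : Relations G)

/-- The functions `P ↦ ‖P(f)‖` on `*`-polynomials, for all families `f` satisfying the relations.
Up to isomorphism of the generated C*-algebras these are all such families; note that they are
indexed by a type in `Type u`. -/
def Index : Type u :=
  {ρ : Poly G → ℝ // ∃ (C : Type u) (_ : NonUnitalCStarAlgebra C) (f : G → C),
    R.Holds C f ∧ ∀ P, ρ P = ‖eval f P‖}

/-- A C*-algebra containing a family with the prescribed norms. -/
def Index.Carrier {R : Relations G} (ρ : Index R) : Type u := ρ.2.choose

instance {R : Relations G} (ρ : Index R) : NonUnitalCStarAlgebra ρ.Carrier :=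
  ρ.2.choose_spec.choose

/-- A family with the prescribed norms. -/
def Index.family {R : Relations G} (ρ : Index R) : G → ρ.Carrier :=
  ρ.2.choose_spec.choose_spec.choose

theorem Index.holds {R : Relations G} (ρ : Index R) : R.Holds ρ.Carrier ρ.family :=
  ρ.2.choose_spec.choose_spec.choose_spec.1

theorem Index.norm_eval {R : Relations G} (ρ : Index R) (P : Poly G) :
    ‖eval ρ.family P‖ = ρ.1 P :=
  (ρ.2.choose_spec.choose_spec.choose_spec.2 P).symm

/-- The C*-algebra of bounded families in the product of the C*-algebras `ρ.Carrier`. -/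
abbrev BigProduct : Type u := lp (fun ρ : Index R => ρ.Carrier) ⊤

/-- The direct sum of all families satisfying the relations. -/
def bigFamily (g : G) : BigProduct R :=
  ⟨fun ρ => ρ.family g, memℓp_infty
    ⟨1, by rintro _ ⟨ρ, rfl⟩; exact R.norm_le_one _ _ ρ.holds g⟩⟩

/-- The coordinate projections of the product. -/
def proj (ρ : Index R) : BigProduct R →⋆ₙₐ[ℂ] ρ.Carrier where
  toFun x := x ρ
  map_smul' _ _ := rfl
  map_zero' := rfl
  map_add' _ _ := rfl
  map_mul' _ _ := rfl
  map_star' _ := rfl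

/-- The universal C*-algebra with generators indexed by `G`, subject to the relations `R`: the
C*-algebra generated by the direct sum of all families satisfying the relations. -/
def Alg : Type u := gensub (bigFamily R)

instance : NonUnitalCStarAlgebra (Alg R) :=
  NonUnitalStarSubalgebra.nonUnitalCStarAlgebra (gensub (bigFamily R))
    (h_closed := isClosed_gensub _)

/-- The generators of the universal C*-algebra. -/
def gen (g : G) : Alg R := ⟨bigFamily R g, mem_gensub _ g⟩

/-- The inclusion of the universal C*-algebra into the product. -/
def incl : Alg R →⋆ₙₐ[ℂ] BigProduct R := NonUnitalStarSubalgebraClass.subtype (gensub (bigFamily R))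

theorem incl_injective : Function.Injective (incl R) := Subtype.val_injective

theorem proj_incl_gen (ρ : Index R) (g : G) : proj R ρ (incl R (gen R g)) = ρ.family g := rfl

theorem ext_of_proj {x y : Alg R} (h : ∀ ρ, proj R ρ (incl R x) = proj R ρ (incl R y)) : x = y :=
  incl_injective R (lp.ext (funext h))

/-- The generators generate the universal C*-algebra. -/
theorem gensub_gen : gensub (gen R) = ⊤ := by
  have : IsClosed (gensub (gen R) : Set (Alg R)) := isClosed_gensub _
  let ψ := (incl R).comp (NonUnitalStarSubalgebraClass.subtype (gensub (gen R)))
  have hinj : Function.Injective ψ := (incl_injective R).comp Subtype.val_injective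
  have hiso : Isometry ψ := NonUnitalStarAlgHom.isometry ψ hinj
  have hle : gensub (bigFamily R) ≤ NonUnitalStarAlgHom.range ψ :=
    gensub_le _ hiso.isClosedEmbedding.isClosed_range
      fun g => ⟨⟨gen R g, mem_gensub _ g⟩, rfl⟩
  rw [eq_top_iff]
  rintro x -
  obtain ⟨y, hy⟩ := hle x.2
  have : (y : Alg R) = x := incl_injective R hy
  exact this ▸ y.2

/-- Two `*`-homomorphisms which agree on the generators are equal. -/
theorem hom_ext {C : Type v} [NonUnitalCStarAlgebra C] {φ ψ : Alg R →⋆ₙₐ[ℂ] C}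
    (h : ∀ g, φ (gen R g) = ψ (gen R g)) : φ = ψ := by
  have hle : gensub (gen R) ≤ NonUnitalStarAlgHom.equalizer φ ψ :=
    gensub_le _ (isClosed_eq (continuous_hom φ) (continuous_hom ψ)) h
  ext x
  exact hle (by rw [gensub_gen]; trivial)

theorem norm_eval_le {C : Type u} [NonUnitalCStarAlgebra C] (f : G → C) (hf : R.Holds C f)
    (P : Poly G) : ‖eval f P‖ ≤ ‖eval (bigFamily R) P‖ := by
  let ρ : Index R := ⟨fun P => ‖eval f P‖, C, inferInstance, f, hf, fun _ => rfl⟩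
  have h1 : ‖eval f P‖ = ‖eval ρ.family P‖ := (ρ.norm_eval P).symm
  have h2 : eval ρ.family P = proj R ρ (eval (bigFamily R) P) :=
    (eval_natural (proj R ρ) (bigFamily R) P).symm
  rw [h1, h2]
  exact lp.norm_apply_le_norm ENNReal.top_ne_zero _ ρ

/-- The universal property, for families in C*-algebras in `Type u`. -/
theorem exists_hom {C : Type u} [NonUnitalCStarAlgebra C] (f : G → C) (hf : R.Holds C f) :
    ∃ φ : Alg R →⋆ₙₐ[ℂ] C, ∀ g, φ (gen R g) = f g :=
  exists_hom_of_norm_le (bigFamily R) f (norm_eval_le R f hf)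

end UniversalCStar

/-- An element of a C*-algebra is positive if it is of the form `z* z`. -/
def IsPosElem {C : Type*} [NonUnitalCStarAlgebra C] (x : C) : Prop := ∃ z : C, x = star z * z

theorem IsPosElem.map {C D : Type*} [NonUnitalCStarAlgebra C] [NonUnitalCStarAlgebra D]
    (φ : C →⋆ₙₐ[ℂ] D) {x : C} (h : IsPosElem x) : IsPosElem (φ x) := by
  obtain ⟨z, rfl⟩ := h
  exact ⟨φ z, by rw [map_mul, map_star]⟩

theorem IsPosElem.of_map {C D : Type*} [NonUnitalCStarAlgebra C] [NonUnitalCStarAlgebra D]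
    (φ : C →⋆ₙₐ[ℂ] D) (hφ : Function.Injective φ) {x : C} (h : IsPosElem (φ x)) :
    IsPosElem x := by
  let _ := CStarAlgebra.spectralOrder C
  let _ := CStarAlgebra.spectralOrderedRing C
  let _ := CStarAlgebra.spectralOrder D
  let _ := CStarAlgebra.spectralOrderedRing D
  have hx0 : 0 ≤ φ x := by
    obtain ⟨z, hz⟩ := h
    rw [hz]
    exact star_mul_self_nonneg z
  have hsa : IsSelfAdjoint x := hφ (by rw [map_star]; exact (IsSelfAdjoint.of_nonneg hx0))
  have hneg : φ (x⁻) = (φ x)⁻ := by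
    rw [CFC.negPart_def, CFC.negPart_def]
    exact NonUnitalStarAlgHom.map_cfcₙ φ _ x (hφ := UniversalCStar.continuous_hom φ)
      (ha := hsa) (hφa := hsa.map φ)
  have h0 : x⁻ = 0 := hφ (by
    rw [hneg, map_zero]
    exact (CFC.negPart_eq_zero_iff _ (IsSelfAdjoint.of_nonneg hx0)).2 hx0)
  exact CStarAlgebra.nonneg_iff_eq_star_mul_self.1 ((CFC.negPart_eq_zero_iff x hsa).1 h0)

theorem IsPosElem.of_lp {I : Type*} {C : I → Type*} [∀ i, NonUnitalCStarAlgebra (C i)]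
    (x : lp C ⊤) (h : ∀ i, IsPosElem (x i)) : IsPosElem x := by
  choose z hz using h
  have hb : Memℓp z ⊤ := memℓp_infty ⟨1 + ‖x‖, by
    rintro _ ⟨i, rfl⟩
    have h1 : ‖z i‖ * ‖z i‖ ≤ ‖x‖ := by
      rw [← CStarRing.norm_star_mul_self, ← hz i]
      exact lp.norm_apply_le_norm ENNReal.top_ne_zero x i
    change ‖z i‖ ≤ 1 + ‖x‖
    nlinarith [sq_nonneg (‖z i‖ - 1), norm_nonneg (z i)]⟩
  exact ⟨⟨z, hb⟩, lp.ext (funext hz)⟩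

/-- A `*`-homomorphism between C*-algebras with dense range is surjective. -/
theorem surjective_of_denseRange {C D : Type*} [NonUnitalCStarAlgebra C] [NonUnitalCStarAlgebra D]
    (φ : C →⋆ₙₐ[ℂ] D) (h : DenseRange φ) : Function.Surjective φ := by
  have hc := UniversalCStar.continuous_hom φ
  have hsa : ∀ x : C, IsSelfAdjoint x → ∃ y, φ y = φ x ∧ ‖y‖ ≤ ‖φ x‖ := by
    intro x hx
    let c := ‖φ x‖
    let f : ℝ → ℝ := fun t => max (-c) (min c t)
    have hc0 : 0 ≤ c := norm_nonneg _
    have hf : Continuous f := by fun_prop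
    have hf0 : f 0 = 0 := by simp [f, hc0]
    refine ⟨cfcₙ f x, ?_, ?_⟩
    · rw [NonUnitalStarAlgHom.map_cfcₙ φ f x (hf := hf.continuousOn) (hf₀ := hf0) (hφ := hc)
        (ha := hx) (hφa := hx.map φ)]
      have : Set.EqOn f id (quasispectrum ℝ (φ x)) := by
        intro t ht
        have hn : ‖t‖ ≤ c := by
          have := NonUnitalIsometricContinuousFunctionalCalculus.norm_quasispectrum_le
            (φ x) ht (hx.map φ)
          exact this
        rw [Real.norm_eq_abs, abs_le] at hn
        simp [f, hn.1, hn.2]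
      rw [cfcₙ_congr this, cfcₙ_id ℝ (φ x) (hx.map φ)]
    · refine norm_cfcₙ_le fun t _ => ?_
      rw [Real.norm_eq_abs, abs_le]
      exact ⟨le_max_left _ _, max_le (by linarith) (min_le_left _ _)⟩
  let F : NormedAddGroupHom C D :=
    { toFun := φ
      map_add' := map_add φ
      bound' := ⟨1, fun x => by simpa using NonUnitalStarAlgHom.norm_apply_le φ x⟩ }
  have hF : F.SurjectiveOnWith F.range 2 := by
    rintro _ ⟨x, rfl⟩
    obtain ⟨a, ha, ha'⟩ := hsa (realPart x) (realPart x).2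
    obtain ⟨b, hb, hb'⟩ := hsa (imaginaryPart x) (imaginaryPart x).2
    refine ⟨a + Complex.I • b, ?_, ?_⟩
    · change φ (a + Complex.I • b) = φ x
      rw [map_add, map_smul, ha, hb, ← map_smul, ← map_add, realPart_add_I_smul_imaginaryPart]
    · change _ ≤ 2 * ‖φ x‖
      have h1 : ‖φ (realPart x : C)‖ ≤ ‖φ x‖ := by
        have e : φ (realPart x : C) = realPart (φ x) := by
          rw [realPart_apply_coe, realPart_apply_coe, ← map_star, ← map_add]
          exact map_smul (φ.restrictScalars ℝ) _ _
        rw [e]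
        exact realPart.norm_le (φ x)
      have h2 : ‖φ (imaginaryPart x : C)‖ ≤ ‖φ x‖ := by
        have e : φ (imaginaryPart x : C) = imaginaryPart (φ x) := by
          rw [imaginaryPart_apply_coe, imaginaryPart_apply_coe, ← map_star, ← map_sub, map_smul]
          congr 1
          exact map_smul (φ.restrictScalars ℝ) _ _
        rw [e]
        exact imaginaryPart.norm_le (φ x)
      calc ‖a + Complex.I • b‖ ≤ ‖a‖ + ‖Complex.I • b‖ := norm_add_le _ _
        _ = ‖a‖ + ‖b‖ := by simp [norm_smul]
        _ ≤ 2 * ‖φ x‖ := by linarith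
  intro y
  obtain ⟨x, hx, -⟩ := controlled_closure_of_complete (by norm_num) one_pos hF y (h y)
  exact ⟨x, hx⟩

namespace Katsura

variable {ι : Type u}

/-- `Ω_A(i) = {j | A i j ≥ 1}`. A row-finite integer matrix indexed by `ι` is represented by
its rows, which are finitely supported functions. -/
def omegaRow (A : ι → ι →₀ ℤ) (i : ι) : Finset ι := (A i).support.filter fun j => 1 ≤ A i j

theorem mem_omegaRow {A : ι → ι →₀ ℤ} {i j : ι} : j ∈ omegaRow A i ↔ 1 ≤ A i j := by
  simp only [omegaRow, Finset.mem_filter, Finsupp.mem_support_iff]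
  constructor
  · exact fun h => h.2
  · exact fun h => ⟨by omega, h⟩

/-- The standing condition on the matrices: `A` has entries in `ℕ`, every `Ω_A(i)` is nonempty, and `B` vanishes
outside `Ω_A`. -/
structure StandingCondition (A B : ι → ι →₀ ℤ) : Prop where
  nonneg : ∀ i j, 0 ≤ A i j
  omegaRow_nonempty : ∀ i, (omegaRow A i).Nonempty
  eq_zero : ∀ i j, j ∉ omegaRow A i → B i j = 0

/-- The index set of the generators: `p_i` and `u_i` for `i ∈ ι`, and `s_{i,j,n}` for
`(i,j) ∈ Ω_A` and `n ∈ ℤ`. -/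
inductive Gen (A : ι → ι →₀ ℤ) : Type u
  | p (i : ι) : Gen A
  | u (i : ι) : Gen A
  | s (i j : ι) (h : 1 ≤ A i j) (n : ℤ) : Gen A

/-- The element `∑_{j ∈ Ω_A(i)} ∑_{n = 1}^{A i j} s_{i,j,n+k j} s_{i,j,n}*`. -/
def rowSum (A : ι → ι →₀ ℤ) {C : Type v} [NonUnitalCStarAlgebra C] (f : Gen A → C) (i : ι)
    (k : ι → ℤ) : C :=
  ∑ j ∈ (omegaRow A i).attach, ∑ n ∈ Finset.Icc 1 (A i j),
    f (.s i j (mem_omegaRow.1 j.2) (n + k j)) * star (f (.s i j (mem_omegaRow.1 j.2) n))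

/-- The relations common to both algebras: the `p_i` are mutually orthogonal projections, the
`u_i` are partial unitaries with `u_i* u_i = u_i u_i* = p_i`, the `s_{i,j,n}` are partial isometries,
`s_{i,j,n} u_j = s_{i,j,n+A i j}`, `u_i s_{i,j,n} = s_{i,j,n+B i j}`, and
`s_{i,j,n}* s_{i,j,n} = p_j`. -/
structure BaseRelations (A B : ι → ι →₀ ℤ) {C : Type v} [NonUnitalCStarAlgebra C]
    (f : Gen A → C) : Prop where
  isStarProjection : ∀ i, IsStarProjection (f (.p i))
  orthogonal : ∀ i j, i ≠ j → f (.p i) * f (.p j) = 0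
  star_u_mul_u : ∀ i, star (f (.u i)) * f (.u i) = f (.p i)
  u_mul_star_u : ∀ i, f (.u i) * star (f (.u i)) = f (.p i)
  partialIsometry : ∀ i j h n, f (.s i j h n) * star (f (.s i j h n)) * f (.s i j h n) =
    f (.s i j h n)
  s_mul_u : ∀ i j h n, f (.s i j h n) * f (.u j) = f (.s i j h (n + A i j))
  u_mul_s : ∀ i j h n, f (.u i) * f (.s i j h n) = f (.s i j h (n + B i j))
  star_s_mul_s : ∀ i j h n, star (f (.s i j h n)) * f (.s i j h n) = f (.p j)

/-- The defining relations of `𝒯_{A,B}`: the base relations, and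
`p_i ≥ ∑_{j ∈ Ω_A(i)} ∑_{n = 1}^{A i j} s_{i,j,n} s_{i,j,n}*`. -/
structure ToeplitzRelations (A B : ι → ι →₀ ℤ) {C : Type v} [NonUnitalCStarAlgebra C]
    (f : Gen A → C) : Prop extends BaseRelations A B f where
  rowSum_le : ∀ i, IsPosElem (f (.p i) - rowSum A f i 0)

/-- The defining relations of `𝒪_{A,B}`: the base relations, and
`p_i = ∑_{j ∈ Ω_A(i)} ∑_{n = 1}^{A i j} s_{i,j,n} s_{i,j,n}*`. -/
structure QuotientRelations (A B : ι → ι →₀ ℤ) {C : Type v} [NonUnitalCStarAlgebra C]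
    (f : Gen A → C) : Prop extends BaseRelations A B f where
  rowSum_eq : ∀ i, f (.p i) = rowSum A f i 0

variable {A B : ι → ι →₀ ℤ}

theorem QuotientRelations.toeplitz {C : Type v} [NonUnitalCStarAlgebra C] {f : Gen A → C}
    (h : QuotientRelations A B f) : ToeplitzRelations A B f :=
  { h.toBaseRelations with
    rowSum_le := fun i => ⟨0, by rw [h.rowSum_eq i, sub_self, mul_zero]⟩ }

theorem BaseRelations.norm_le_one {C : Type v} [NonUnitalCStarAlgebra C] {f : Gen A → C}
    (h : BaseRelations A B f) (g : Gen A) : ‖f g‖ ≤ 1 := by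
  have key : ∀ x : C, ‖star x * x‖ ≤ 1 → ‖x‖ ≤ 1 := by
    intro x hx
    rw [CStarRing.norm_star_mul_self] at hx
    nlinarith [norm_nonneg x]
  have hp : ∀ i, ‖f (.p i)‖ ≤ 1 := by
    intro i
    have h1 : star (f (.p i)) * f (.p i) = f (.p i) := by
      rw [(h.isStarProjection i).isSelfAdjoint.star_eq]
      exact (h.isStarProjection i).isIdempotentElem
    have h2 : ‖f (.p i)‖ * ‖f (.p i)‖ = ‖f (.p i)‖ := by
      rw [← CStarRing.norm_star_mul_self, h1]
    nlinarith [norm_nonneg (f (.p i))]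
  rcases g with i | i | ⟨i, j, hij, n⟩
  · exact hp i
  · exact key _ (by rw [h.star_u_mul_u]; exact hp i)
  · exact key _ (by rw [h.star_s_mul_s]; exact hp j)

theorem map_rowSum {C D : Type*} [NonUnitalCStarAlgebra C] [NonUnitalCStarAlgebra D]
    (φ : C →⋆ₙₐ[ℂ] D) (f : Gen A → C) (i : ι) (k : ι → ℤ) :
    φ (rowSum A f i k) = rowSum A (fun g => φ (f g)) i k := by
  simp only [rowSum, map_sum, map_mul, map_star]

theorem BaseRelations.of_separating {C : Type*} [NonUnitalCStarAlgebra C] {K : Type*}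
    {D : K → Type*} [∀ k, NonUnitalCStarAlgebra (D k)] (π : ∀ k, C →⋆ₙₐ[ℂ] D k)
    (hπ : ∀ x y : C, (∀ k, π k x = π k y) → x = y) {f : Gen A → C}
    (h : ∀ k, BaseRelations A B fun g => π k (f g)) : BaseRelations A B f where
  isStarProjection i :=
    { isIdempotentElem := hπ _ _ fun k => by
        rw [map_mul]; exact ((h k).isStarProjection i).isIdempotentElem
      isSelfAdjoint := hπ _ _ fun k => by
        rw [map_star]; exact ((h k).isStarProjection i).isSelfAdjoint }
  orthogonal i j hij := hπ _ _ fun k => by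
    rw [map_mul, map_zero]; exact (h k).orthogonal i j hij
  star_u_mul_u i := hπ _ _ fun k => by
    rw [map_mul, map_star]; exact (h k).star_u_mul_u i
  u_mul_star_u i := hπ _ _ fun k => by
    rw [map_mul, map_star]; exact (h k).u_mul_star_u i
  partialIsometry i j hij n := hπ _ _ fun k => by
    rw [map_mul, map_mul, map_star]; exact (h k).partialIsometry i j hij n
  s_mul_u i j hij n := hπ _ _ fun k => by
    rw [map_mul]; exact (h k).s_mul_u i j hij n
  u_mul_s i j hij n := hπ _ _ fun k => by
    rw [map_mul]; exact (h k).u_mul_s i j hij n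
  star_s_mul_s i j hij n := hπ _ _ fun k => by
    rw [map_mul, map_star]; exact (h k).star_s_mul_s i j hij n

variable (A B)

/-- The relations of `𝒯_{A,B}`, as data for the universal construction. -/
def toeplitzRel : UniversalCStar.Relations (Gen A) where
  Holds _ _ f := ToeplitzRelations A B f
  norm_le_one _ _ _ h := h.norm_le_one

/-- The relations of `𝒪_{A,B}`, as data for the universal construction. -/
def quotientRel : UniversalCStar.Relations (Gen A) where
  Holds _ _ f := QuotientRelations A B f
  norm_le_one _ _ _ h := h.norm_le_one

/-- The C*-algebra `𝒯_{A,B}`. -/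
abbrev TAlg : Type u := UniversalCStar.Alg (toeplitzRel A B)

/-- The C*-algebra `𝒪_{A,B}`. -/
abbrev OAlg : Type u := UniversalCStar.Alg (quotientRel A B)

/-- The generators of `𝒯_{A,B}`. -/
abbrev tGen (g : Gen A) : TAlg A B := UniversalCStar.gen (toeplitzRel A B) g

/-- The generators of `𝒪_{A,B}`. -/
abbrev oGen (g : Gen A) : OAlg A B := UniversalCStar.gen (quotientRel A B) g

/-- The generators of `𝒯_{A,B}` satisfy the defining relations. -/
theorem tGen_relations : ToeplitzRelations A B (tGen A B) where
  toBaseRelations := BaseRelations.of_separating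
    (fun ρ => (UniversalCStar.proj (toeplitzRel A B) ρ).comp (UniversalCStar.incl _))
    (fun _ _ h => UniversalCStar.ext_of_proj _ h)
    (fun ρ => (show ToeplitzRelations A B ρ.family from ρ.holds).toBaseRelations)
  rowSum_le i := by
    refine IsPosElem.of_map (UniversalCStar.incl _) (UniversalCStar.incl_injective _) ?_
    refine IsPosElem.of_lp _ fun ρ => ?_
    have h : ToeplitzRelations A B ρ.family := ρ.holds
    have e : UniversalCStar.proj (toeplitzRel A B) ρ (UniversalCStar.incl _
        (tGen A B (.p i) - rowSum A (tGen A B) i 0)) = ρ.family (.p i) - rowSum A ρ.family i 0 := by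
      rw [map_sub, map_sub, map_rowSum, map_rowSum]
      rfl
    have h' : IsPosElem (UniversalCStar.proj (toeplitzRel A B) ρ (UniversalCStar.incl _
        (tGen A B (.p i) - rowSum A (tGen A B) i 0))) := by
      rw [e]
      exact h.rowSum_le i
    exact h'

/-- The generators of `𝒪_{A,B}` satisfy the defining relations. -/
theorem oGen_relations : QuotientRelations A B (oGen A B) where
  toBaseRelations := BaseRelations.of_separating
    (fun ρ => (UniversalCStar.proj (quotientRel A B) ρ).comp (UniversalCStar.incl _))
    (fun _ _ h => UniversalCStar.ext_of_proj _ h)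
    (fun ρ => (show QuotientRelations A B ρ.family from ρ.holds).toBaseRelations)
  rowSum_eq i := by
    refine UniversalCStar.ext_of_proj _ fun ρ => ?_
    have h : QuotientRelations A B ρ.family := ρ.holds
    rw [map_rowSum, map_rowSum]
    exact h.rowSum_eq i

/-- The universal property of `𝒯_{A,B}`, for families in C*-algebras in any universe. -/
theorem TAlg.existsUnique_hom {C : Type v} [NonUnitalCStarAlgebra C] (f : Gen A → C)
    (hf : ToeplitzRelations A B f) : ∃! φ : TAlg A B →⋆ₙₐ[ℂ] C, ∀ g, φ (tGen A B g) = f g := by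
  obtain ⟨D, _, f₀, j, hj, hjf⟩ := UniversalCStar.exists_small_model f
  obtain rfl : (fun g => j (f₀ g)) = f := funext hjf
  have h₀ : ToeplitzRelations A B f₀ :=
    { toBaseRelations := BaseRelations.of_separating (fun _ : Unit => j)
        (fun _ _ h => hj (h ())) (fun _ => hf.toBaseRelations)
      rowSum_le := fun i => IsPosElem.of_map j hj (by
        rw [map_sub, map_rowSum]; exact hf.rowSum_le i) }
  obtain ⟨φ, hφ⟩ := UniversalCStar.exists_hom (toeplitzRel A B) f₀ h₀
  exact ⟨j.comp φ, fun g => congrArg j (hφ g), fun ψ hψ =>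
    UniversalCStar.hom_ext _ fun g => (hψ g).trans (congrArg j (hφ g)).symm⟩

/-- The universal property of `𝒪_{A,B}`, for families in C*-algebras in any universe. -/
theorem OAlg.existsUnique_hom {C : Type v} [NonUnitalCStarAlgebra C] (f : Gen A → C)
    (hf : QuotientRelations A B f) : ∃! φ : OAlg A B →⋆ₙₐ[ℂ] C, ∀ g, φ (oGen A B g) = f g := by
  obtain ⟨D, _, f₀, j, hj, hjf⟩ := UniversalCStar.exists_small_model f
  obtain rfl : (fun g => j (f₀ g)) = f := funext hjf
  have h₀ : QuotientRelations A B f₀ :=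
    { toBaseRelations := BaseRelations.of_separating (fun _ : Unit => j)
        (fun _ _ h => hj (h ())) (fun _ => hf.toBaseRelations)
      rowSum_eq := fun i => hj (by rw [map_rowSum]; exact hf.rowSum_eq i) }
  obtain ⟨φ, hφ⟩ := UniversalCStar.exists_hom (quotientRel A B) f₀ h₀
  exact ⟨j.comp φ, fun g => congrArg j (hφ g), fun ψ hψ =>
    UniversalCStar.hom_ext _ fun g => (hψ g).trans (congrArg j (hφ g)).symm⟩

/-- The natural `*`-homomorphism `𝒯_{A,B} → 𝒪_{A,B}`, which maps generators to generators. -/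
def toO : TAlg A B →⋆ₙₐ[ℂ] OAlg A B :=
  (TAlg.existsUnique_hom A B (oGen A B) (oGen_relations A B).toeplitz).choose

theorem toO_gen (g : Gen A) : toO A B (tGen A B g) = oGen A B g :=
  (TAlg.existsUnique_hom A B (oGen A B) (oGen_relations A B).toeplitz).choose_spec.1 g

theorem toO_surjective : Function.Surjective (toO A B) := by
  refine surjective_of_denseRange _ fun y => ?_
  have hle : UniversalCStar.gensub (oGen A B) ≤
      (NonUnitalStarAlgHom.range (toO A B)).topologicalClosure :=
    UniversalCStar.gensub_le _ (NonUnitalStarSubalgebra.isClosed_topologicalClosure _) fun g =>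
      NonUnitalStarSubalgebra.le_topologicalClosure _ ⟨tGen A B g, toO_gen A B g⟩
  exact hle (by rw [UniversalCStar.gensub_gen]; trivial)

/-- The ideal `𝒥_{A,B}`, the kernel of the natural surjection `𝒯_{A,B} → 𝒪_{A,B}`. -/
def idealJ : TwoSidedIdeal (TAlg A B) := TwoSidedIdeal.ker (toO A B)

/-- The element `u_i' = u_i - ∑_{j ∈ Ω_A(i)} ∑_{n = 1}^{A i j} s_{i,j,n+B i j} s_{i,j,n}*`
of `𝒯_{A,B}`. -/
def uPrime (i : ι) : TAlg A B := tGen A B (.u i) - rowSum A (tGen A B) i (B i)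

end Katsura

/-- A two-sided ideal of a C*-algebra is essential if it has nonzero intersection with every
nonzero closed two-sided ideal. -/
def IsEssentialIdeal {C : Type*} [NonUnitalCStarAlgebra C] (J : TwoSidedIdeal C) : Prop :=
  ∀ I : TwoSidedIdeal C, IsClosed (I : Set C) → I ⊓ J = ⊥ → I = ⊥

end

/-!
Write `p_i' = p_i - ∑ s s*` for the `i`-th defect projection (`Katsura.defect`), where the sum is
the one in the third relation. It is a projection which commutes with `u_i`, and `u_i' = u_i p_i'`
is a unitary in the corner that it cuts out. Both assertions of the theorem follow from three facts.

* An ideal `I` of `𝒯_{A,B}` with `I p_i' = 0` for all `i` is zero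
  (`Katsura.eq_bot_of_mul_defect_eq_zero`). Let `S` be the unilateral shift. For a representation
  `π` of `𝒯_{A,B}` on a Hilbert space `H`, the operators `π(s_{i,j,n}) ⊗ S`, `π(u_i) ⊗ 1` and
  `π(p_i) ⊗ 1` satisfy the relations again and define a representation `Ψ` on `H ⊗ ℓ²(ℕ)`. Since
  powers of `S*` tend to zero, iterating `p_i = p_i' + ∑ s s*` shows that a vector `p_i h ⊗ δ_n` is
  a finite sum of vectors in the ranges of `Ψ(s_{e_1} ⋯ s_{e_m} p_j')`; hence `Ψ` vanishes on
  `I p_i`. On the other hand, `S` almost fixes the unit vectors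
  `(N + 1)^{-1/2} (δ_0 + ⋯ + δ_N)`, and therefore `Ψ(x) = 0` implies `π(x) = 0`
  (`Katsura.tendsto_averaging`). The GNS representations separate the points of `𝒯_{A,B}`
  (`exists_positiveLinearMap_apply_ne_zero`), so `I p_i = 0` for all `i`, and `I = 0`.
* The corner `p_i' 𝒯_{A,B} p_i'` is the C*-algebra generated by `u_i'`
  (`Katsura.defect_mul_mul_defect_mem`), because `p_i' s_{i,j,n} = 0`.
* The spectrum of `u_i'` contains the circle (`Katsura.sphere_subset_quasispectrum_uPrime`). On the
  Fock space, whose basis consists of paths with an integer attached to their ends, the generators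
  permute the basis partially, and `u_i'` acts as a bilateral shift on the paths of length zero.

The projections `p_i'` lie in `𝒥_{A,B}`, so an ideal that meets `𝒥_{A,B}` trivially annihilates
them and vanishes by the first fact. If the spectra of the `φ(u_i')` contain the circle, then `φ` is
injective on the corners by the second fact and the continuous functional calculus, hence its
kernel annihilates the `p_i'` and vanishes. Conversely, an injective `φ` preserves the spectrum of
the normal element `u_i'`.
-/

/-! ### Ranges of partial isometries under a projection -/

section PartialIsometries

variable {C K : Type*} [NonUnitalCStarAlgebra C]

theorem mul_eq_self_of_star_mul_self {x p : C} (hp : IsStarProjection p) (h : star x * x = p) :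
    x * p = x := by
  have hs : star p = p := hp.isSelfAdjoint
  have hi : p * p = p := hp.isIdempotentElem
  have h0 : star (x * p - x) * (x * p - x) = 0 := by
    have e : star (x * p - x) * (x * p - x) =
        p * (star x * x) * p - p * (star x * x) - star x * x * p + star x * x := by
      rw [star_sub, star_mul, hs]; noncomm_ring
    rw [e, h, hi, hi]; abel
  exact sub_eq_zero.1 ((CStarRing.star_mul_self_eq_zero_iff _).1 h0)

/-- Partial isometries in the range of `p` whose range projections add up to at most `p` have
mutually orthogonal ranges: compressing `p - ∑ s_l s_l* ≥ 0` by `s_k` leaves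
`-∑_{l ≠ k} (s_l* s_k)* (s_l* s_k) ≥ 0`. -/
theorem star_mul_eq_zero_of_isPosElem_sub_sum {F : Finset K} {s : K → C} {p : C}
    (hp : ∀ k ∈ F, p * s k = s k) (hs : ∀ k ∈ F, s k * star (s k) * s k = s k)
    (hpos : IsPosElem (p - ∑ k ∈ F, s k * star (s k))) {k l : K} (hk : k ∈ F) (hl : l ∈ F)
    (hlk : l ≠ k) : star (s l) * s k = 0 := by
  classical
  let _ := CStarAlgebra.spectralOrder C
  let _ := CStarAlgebra.spectralOrderedRing C
  obtain ⟨z, hz⟩ := hpos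
  have h0 : star (z * s k) * (z * s k) +
      ∑ l ∈ F.erase k, star (star (s l) * s k) * (star (s l) * s k) = 0 := by
    have e1 : star (z * s k) * (z * s k) = star (s k) * (star z * z) * s k := by
      simp only [star_mul, mul_assoc]
    have e2 : ∀ l, star (star (s l) * s k) * (star (s l) * s k) =
        star (s k) * (s l * star (s l)) * s k := by
      intro l; simp only [star_mul, star_star, mul_assoc]
    have e3 : star (s k) * (s k * star (s k)) * s k = star (s k) * p * s k := by
      rw [mul_assoc, hs k hk, mul_assoc, hp k hk]
    rw [e1, ← hz, ← Finset.add_sum_erase F _ hk]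
    simp only [e2, mul_sub, sub_mul, mul_add, add_mul, Finset.mul_sum, Finset.sum_mul, e3]
    abel
  have h1 : 0 ≤ ∑ l ∈ F.erase k, star (star (s l) * s k) * (star (s l) * s k) :=
    Finset.sum_nonneg fun _ _ => star_mul_self_nonneg _
  have h2 := (add_eq_zero_iff_of_nonneg (star_mul_self_nonneg _) h1).1 h0
  have h3 := (Finset.sum_eq_zero_iff_of_nonneg fun _ _ => star_mul_self_nonneg _).1 h2.2 l
    (Finset.mem_erase.2 ⟨hlk, hl⟩)
  exact (CStarRing.star_mul_self_eq_zero_iff _).1 h3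

theorem sum_mul_star_mul {F : Finset K} {s : K → C}
    (hs : ∀ k ∈ F, s k * star (s k) * s k = s k)
    (horth : ∀ k ∈ F, ∀ l ∈ F, l ≠ k → star (s l) * s k = 0) {k : K} (hk : k ∈ F) :
    (∑ l ∈ F, s l * star (s l)) * s k = s k := by
  rw [Finset.sum_mul, Finset.sum_eq_single k]
  · exact hs k hk
  · intro l hl hlk
    rw [mul_assoc, horth k hk l hl hlk, mul_zero]
  · exact fun h => absurd hk h

theorem isStarProjection_sub_sum {F : Finset K} {s : K → C} {p : C} (hp : IsStarProjection p)
    (hps : ∀ k ∈ F, p * s k = s k) (hs : ∀ k ∈ F, s k * star (s k) * s k = s k)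
    (horth : ∀ k ∈ F, ∀ l ∈ F, l ≠ k → star (s l) * s k = 0) :
    IsStarProjection (p - ∑ k ∈ F, s k * star (s k)) := by
  set q := ∑ k ∈ F, s k * star (s k) with hq
  have hqs : star q = q := by simp [hq, star_sum]
  have hpst : star p = p := hp.isSelfAdjoint
  have hqq : q * q = q := by
    conv_lhs => rw [hq, ← hq, Finset.mul_sum]
    refine Finset.sum_congr rfl fun k hk => ?_
    rw [← mul_assoc, hq, sum_mul_star_mul hs horth hk]
  have hpq : p * q = q := by
    rw [hq, Finset.mul_sum]
    exact Finset.sum_congr rfl fun k hk => by rw [← mul_assoc, hps k hk]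
  have hqp : q * p = q := by
    have := congrArg star hpq
    rwa [star_mul, hqs, hpst] at this
  refine ⟨?_, ?_⟩
  · change (p - q) * (p - q) = p - q
    have hi : p * p = p := hp.isIdempotentElem
    rw [mul_sub, sub_mul, sub_mul, hi, hqp, hpq, hqq, sub_self, sub_zero]
  · change star (p - q) = p - q
    rw [star_sub, hqs, hpst]

end PartialIsometries

/-! ### Sums over residue systems -/

theorem Int.exists_mem_Icc_eq_add_mul {a : ℤ} (ha : 1 ≤ a) (n : ℤ) :
    ∃ m ∈ Finset.Icc 1 a, ∃ k : ℤ, n = m + k * a := by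
  refine ⟨(n - 1) % a + 1, ?_, (n - 1) / a, ?_⟩
  · have h1 := Int.emod_nonneg (n - 1) (by omega : a ≠ 0)
    have h2 := Int.emod_lt_of_pos (n - 1) (by omega : 0 < a)
    rw [Finset.mem_Icc]; omega
  · have := Int.emod_add_mul_ediv (n - 1) a
    linarith [mul_comm ((n - 1) / a) a]

/-- The sum of a periodic function over a period is invariant under translation. -/
theorem Function.Periodic.sum_Icc_add {M : Type*} [AddCommMonoid M] [IsCancelAdd M]
    {e : ℤ → M} {a : ℤ} (ha : 1 ≤ a) (he : Function.Periodic e a) (b : ℤ) :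
    ∑ n ∈ Finset.Icc 1 a, e (n + b) = ∑ n ∈ Finset.Icc 1 a, e n := by
  have step : ∀ c : ℤ, ∑ n ∈ Finset.Icc 1 a, e (n + (c + 1)) = ∑ n ∈ Finset.Icc 1 a, e (n + c) := by
    intro c
    have e1 : ∑ n ∈ Finset.Icc 1 a, e (n + (c + 1)) = ∑ n ∈ Finset.Icc 2 (a + 1), e (n + c) := by
      refine Finset.sum_nbij' (fun n => n + 1) (fun n => n - 1) ?_ ?_ ?_ ?_ ?_ <;>
        simp only [Finset.mem_Icc] <;> intros <;> first | omega | (congr 1; ring)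
    have e2 : ∑ n ∈ Finset.Icc 1 (a + 1), e (n + c) =
        e (1 + c) + ∑ n ∈ Finset.Icc 2 (a + 1), e (n + c) := by
      rw [← Finset.sum_insert (f := fun n => e (n + c)) (by simp)]
      congr 1; ext n; simp only [Finset.mem_Icc, Finset.mem_insert]; omega
    have e3 : ∑ n ∈ Finset.Icc 1 (a + 1), e (n + c) =
        e (1 + c) + ∑ n ∈ Finset.Icc 1 a, e (n + c) := by
      have : e (1 + c) = e (a + 1 + c) := by
        rw [← he (1 + c)]; congr 1; ring
      rw [this, ← Finset.sum_insert (f := fun n => e (n + c)) (by simp)]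
      congr 1; ext n; simp only [Finset.mem_Icc, Finset.mem_insert]; omega
    rw [e1]
    exact add_left_cancel (e2.symm.trans e3)
  induction b using Int.induction_on with
  | zero => simp
  | succ b ih => rw [step, ih]
  | pred b ih => rw [← ih, ← step]; simp

namespace Katsura

variable {ι : Type u} {A B : ι → ι →₀ ℤ} {C : Type*} [NonUnitalCStarAlgebra C] {f : Gen A → C}

/-! ### Consequences of the relations -/

namespace BaseRelations

variable (h : BaseRelations A B f)
include h

theorem star_p (i : ι) : star (f (.p i)) = f (.p i) := (h.isStarProjection i).isSelfAdjoint

theorem p_mul_p (i : ι) : f (.p i) * f (.p i) = f (.p i) :=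
  (h.isStarProjection i).isIdempotentElem

theorem u_mul_p (i : ι) : f (.u i) * f (.p i) = f (.u i) :=
  mul_eq_self_of_star_mul_self (h.isStarProjection i) (h.star_u_mul_u i)

theorem p_mul_u (i : ι) : f (.p i) * f (.u i) = f (.u i) := by
  rw [← h.u_mul_star_u, mul_assoc, h.star_u_mul_u, h.u_mul_p]

theorem p_mul_star_u (i : ι) : f (.p i) * star (f (.u i)) = star (f (.u i)) := by
  simpa [h.star_p] using congrArg star (h.u_mul_p i)

theorem s_mul_p (i j : ι) (hij : 1 ≤ A i j) (n : ℤ) :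
    f (.s i j hij n) * f (.p j) = f (.s i j hij n) := by
  rw [← h.star_s_mul_s i j hij n, ← mul_assoc, h.partialIsometry]

theorem u_mul_s_sub (i j : ι) (hij : 1 ≤ A i j) (n : ℤ) :
    f (.u i) * f (.s i j hij (n - B i j)) = f (.s i j hij n) := by
  rw [h.u_mul_s, sub_add_cancel]

theorem p_mul_s (i j : ι) (hij : 1 ≤ A i j) (n : ℤ) :
    f (.p i) * f (.s i j hij n) = f (.s i j hij n) := by
  rw [← h.u_mul_s_sub, ← mul_assoc, h.p_mul_u]

theorem p_mul_star_s (i j : ι) (hij : 1 ≤ A i j) (n : ℤ) :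
    f (.p j) * star (f (.s i j hij n)) = star (f (.s i j hij n)) := by
  simpa [h.star_p] using congrArg star (h.s_mul_p i j hij n)

theorem star_s_mul_p (i j : ι) (hij : 1 ≤ A i j) (n : ℤ) :
    star (f (.s i j hij n)) * f (.p i) = star (f (.s i j hij n)) := by
  simpa [h.star_p] using congrArg star (h.p_mul_s i j hij n)

theorem star_u_mul_s (i j : ι) (hij : 1 ≤ A i j) (n : ℤ) :
    star (f (.u i)) * f (.s i j hij n) = f (.s i j hij (n - B i j)) := by
  rw [← h.u_mul_s_sub, ← mul_assoc, h.star_u_mul_u, h.p_mul_s]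

theorem s_mul_star_u (i j : ι) (hij : 1 ≤ A i j) (n : ℤ) :
    f (.s i j hij n) * star (f (.u j)) = f (.s i j hij (n - A i j)) := by
  conv_lhs => rw [← sub_add_cancel n (A i j), ← h.s_mul_u]
  rw [mul_assoc, h.u_mul_star_u, h.s_mul_p]

/-- The range projection of `s_{i,j,n}` depends only on `n` modulo `A i j`. -/
theorem s_mul_star_s_periodic (i j : ι) (hij : 1 ≤ A i j) :
    Function.Periodic (fun n => f (.s i j hij n) * star (f (.s i j hij n))) (A i j) := by
  intro n
  change f (.s i j hij (n + A i j)) * star (f (.s i j hij (n + A i j))) = _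
  rw [← h.s_mul_u, star_mul, mul_assoc, ← mul_assoc (f (.u j)), h.u_mul_star_u, h.p_mul_star_s]

theorem s_mul_star_s_add_mul (i j : ι) (hij : 1 ≤ A i j) (n a : ℤ) :
    f (.s i j hij (n + a * A i j)) * star (f (.s i j hij (n + a * A i j))) =
      f (.s i j hij n) * star (f (.s i j hij n)) :=
  (h.s_mul_star_s_periodic i j hij).int_mul a n

end BaseRelations

/-- The pairs `(j, n)` with `j ∈ Ω_A(i)` and `1 ≤ n ≤ A i j`, over which the sum in the relations
extends. -/
noncomputable def rowIndex (A : ι → ι →₀ ℤ) (i : ι) : Finset (Σ _ : {j // j ∈ omegaRow A i}, ℤ) :=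
  (omegaRow A i).attach.sigma fun j => Finset.Icc 1 (A i j)

theorem rowSum_zero (f : Gen A → C) (i : ι) :
    rowSum A f i 0 = ∑ k ∈ rowIndex A i, f (.s i k.1 (mem_omegaRow.1 k.1.2) k.2) *
      star (f (.s i k.1 (mem_omegaRow.1 k.1.2) k.2)) := by
  rw [rowSum, rowIndex, Finset.sum_sigma]
  simp

/-- To obtain the relations of `𝒯_{A,B}`, it suffices to see that the partial isometries which
occur in the sum have orthogonal ranges. -/
theorem BaseRelations.toeplitz (h : BaseRelations A B f)
    (horth : ∀ i j k (hij : 1 ≤ A i j) (hik : 1 ≤ A i k), ∀ n ∈ Finset.Icc 1 (A i j),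
      ∀ m ∈ Finset.Icc 1 (A i k), (j = k → n ≠ m) →
        star (f (.s i j hij n)) * f (.s i k hik m) = 0) : ToeplitzRelations A B f where
  toBaseRelations := h
  rowSum_le i := by
    rw [rowSum_zero]
    have hp := isStarProjection_sub_sum (F := rowIndex A i)
      (s := fun k => f (.s i k.1 (mem_omegaRow.1 k.1.2) k.2)) (h.isStarProjection i)
      (fun k _ => h.p_mul_s _ _ _ _) (fun k _ => h.partialIsometry _ _ _ _) (by
        rintro ⟨j, n⟩ hn ⟨k, m⟩ hm hne
        simp only [rowIndex, Finset.mem_sigma] at hn hm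
        refine horth i k j _ _ m hm.2 n hn.2 fun hkj hmn => hne ?_
        obtain rfl : k = j := Subtype.ext hkj
        rw [hmn])
    exact ⟨_, (by rw [hp.isSelfAdjoint.star_eq]; exact hp.isIdempotentElem.symm)⟩

/-- The projection `p_i - ∑_{j ∈ Ω_A(i)} ∑_{n = 1}^{A i j} s_{i,j,n} s_{i,j,n}*`. -/
noncomputable def defect (A : ι → ι →₀ ℤ) (f : Gen A → C) (i : ι) : C := f (.p i) - rowSum A f i 0

namespace ToeplitzRelations

variable (h : ToeplitzRelations A B f)
include h

theorem star_s_mul_s_of_mem (i j k : ι) (hij : 1 ≤ A i j) (hik : 1 ≤ A i k) (n m : ℤ)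
    (hn : n ∈ Finset.Icc 1 (A i j)) (hm : m ∈ Finset.Icc 1 (A i k)) (hne : j = k → n ≠ m) :
    star (f (.s i j hij n)) * f (.s i k hik m) = 0 := by
  have hpos := h.rowSum_le i
  rw [rowSum_zero] at hpos
  refine star_mul_eq_zero_of_isPosElem_sub_sum (F := rowIndex A i)
    (s := fun k => f (.s i k.1 (mem_omegaRow.1 k.1.2) k.2))
    (fun k _ => h.p_mul_s _ _ _ _) (fun k _ => h.partialIsometry _ _ _ _) hpos
    (k := ⟨⟨k, mem_omegaRow.2 hik⟩, m⟩) (l := ⟨⟨j, mem_omegaRow.2 hij⟩, n⟩) ?_ ?_ ?_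
  · simp only [rowIndex, Finset.mem_sigma]; exact ⟨Finset.mem_attach _ _, hm⟩
  · simp only [rowIndex, Finset.mem_sigma]; exact ⟨Finset.mem_attach _ _, hn⟩
  · intro he
    have h1 := congrArg (fun x => (x.1 : ι)) he
    exact hne h1 (congrArg (fun x => x.2) he)

theorem star_s_mul_s_eq_zero (i j k : ι) (hij : 1 ≤ A i j) (hik : 1 ≤ A i k) (n m : ℤ)
    (hne : ∀ l : ℤ, j = k → m ≠ n + l * A i j) :
    star (f (.s i j hij n)) * f (.s i k hik m) = 0 := by
  obtain ⟨n', hn', a, ha⟩ := Int.exists_mem_Icc_eq_add_mul hij n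
  obtain ⟨m', hm', b, hb⟩ := Int.exists_mem_Icc_eq_add_mul hik m
  have e1 := h.s_mul_star_s_add_mul i j hij n' a
  have e2 := h.s_mul_star_s_add_mul i k hik m' b
  rw [← ha] at e1
  rw [← hb] at e2
  have h0 := h.star_s_mul_s_of_mem i j k hij hik n' m' hn' hm' (by
    rintro rfl rfl
    refine hne (b - a) rfl ?_
    rw [ha, hb]; ring)
  rw [← h.partialIsometry i j hij n, ← h.partialIsometry i k hik m, e1, e2]
  simp only [star_mul, star_star, mul_assoc]
  rw [← mul_assoc (star (f (.s i j hij n'))), h0]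
  simp

/-- Orthogonality of the ranges in the indexing of `rowSum_zero`. -/
theorem row_orthogonal (i : ι) : ∀ k ∈ rowIndex A i, ∀ l ∈ rowIndex A i, l ≠ k →
    star (f (.s i l.1 (mem_omegaRow.1 l.1.2) l.2)) *
      f (.s i k.1 (mem_omegaRow.1 k.1.2) k.2) = 0 := by
  rintro ⟨j, n⟩ hn ⟨k, m⟩ hm hne
  simp only [rowIndex, Finset.mem_sigma] at hn hm
  refine h.star_s_mul_s_of_mem i k j _ _ m n hm.2 hn.2 fun hkj hmn => hne ?_
  obtain rfl : k = j := Subtype.ext hkj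
  rw [hmn]

theorem defect_isStarProjection (i : ι) : IsStarProjection (defect A f i) := by
  rw [defect, rowSum_zero]
  exact isStarProjection_sub_sum (F := rowIndex A i)
    (s := fun k => f (.s i k.1 (mem_omegaRow.1 k.1.2) k.2)) (h.isStarProjection i)
    (fun k _ => h.p_mul_s _ _ _ _) (fun k _ => h.partialIsometry _ _ _ _) (h.row_orthogonal i)

theorem star_defect (i : ι) : star (defect A f i) = defect A f i :=
  (h.defect_isStarProjection i).isSelfAdjoint

theorem defect_mul_s (i j : ι) (hij : 1 ≤ A i j) (n : ℤ) :
    defect A f i * f (.s i j hij n) = 0 := by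
  obtain ⟨n', hn', a, ha⟩ := Int.exists_mem_Icc_eq_add_mul hij n
  have e1 := h.s_mul_star_s_add_mul i j hij n' a
  rw [← ha] at e1
  rw [← h.partialIsometry i j hij n, e1, ← mul_assoc, ← mul_assoc]
  have h0 : rowSum A f i 0 * f (.s i j hij n') = f (.s i j hij n') := by
    rw [rowSum_zero]
    refine sum_mul_star_mul (F := rowIndex A i)
      (s := fun k => f (.s i k.1 (mem_omegaRow.1 k.1.2) k.2))
      (fun k _ => h.partialIsometry _ _ _ _) (h.row_orthogonal i)
      (k := ⟨⟨j, mem_omegaRow.2 hij⟩, n'⟩) ?_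
    simp only [rowIndex, Finset.mem_sigma]; exact ⟨Finset.mem_attach _ _, hn'⟩
  rw [defect, sub_mul, h.p_mul_s, h0, sub_self, zero_mul, zero_mul]

theorem star_s_mul_defect (i j : ι) (hij : 1 ≤ A i j) (n : ℤ) :
    star (f (.s i j hij n)) * defect A f i = 0 := by
  simpa [h.star_defect] using congrArg star (h.defect_mul_s i j hij n)

theorem p_mul_rowSum (i : ι) : f (.p i) * rowSum A f i 0 = rowSum A f i 0 := by
  rw [rowSum_zero, Finset.mul_sum]
  exact Finset.sum_congr rfl fun k _ => by rw [← mul_assoc, h.p_mul_s]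

theorem p_mul_defect (i : ι) : f (.p i) * defect A f i = defect A f i := by
  rw [defect, mul_sub, h.p_mul_p, h.p_mul_rowSum]

theorem defect_mul_p (i : ι) : defect A f i * f (.p i) = defect A f i := by
  simpa [h.star_defect, h.star_p] using congrArg star (h.p_mul_defect i)

theorem p_mul_defect_of_ne {i j : ι} (hij : i ≠ j) : f (.p i) * defect A f j = 0 := by
  rw [← h.p_mul_defect, ← mul_assoc, h.orthogonal i j hij, zero_mul]

theorem u_mul_defect (i : ι) :
    f (.u i) * defect A f i = f (.u i) - rowSum A f i (B i) := by
  rw [defect, mul_sub, h.u_mul_p, rowSum, rowSum, Finset.mul_sum]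
  congr 1
  refine Finset.sum_congr rfl fun j _ => ?_
  rw [Finset.mul_sum]
  refine Finset.sum_congr rfl fun n _ => ?_
  rw [← mul_assoc, h.u_mul_s]
  simp

theorem u_mul_rowSum_mul_star_u (i : ι) :
    f (.u i) * rowSum A f i 0 * star (f (.u i)) = rowSum A f i 0 := by
  rw [rowSum, Finset.mul_sum, Finset.sum_mul]
  refine Finset.sum_congr rfl fun j _ => ?_
  have := (h.s_mul_star_s_periodic i j (mem_omegaRow.1 j.2)).sum_Icc_add (mem_omegaRow.1 j.2)
    (B i j)
  simp only [Pi.zero_apply, add_zero]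
  conv_rhs => rw [← this]
  rw [Finset.mul_sum, Finset.sum_mul]
  refine Finset.sum_congr rfl fun n _ => ?_
  rw [← h.u_mul_s, star_mul]
  simp only [mul_assoc]

theorem u_commute_defect (i : ι) : f (.u i) * defect A f i = defect A f i * f (.u i) := by
  have hr : rowSum A f i 0 * f (.p i) = rowSum A f i 0 := by
    rw [rowSum_zero, Finset.sum_mul]
    exact Finset.sum_congr rfl fun k _ => by rw [mul_assoc, h.star_s_mul_p]
  have : rowSum A f i 0 * f (.u i) = f (.u i) * rowSum A f i 0 := by
    conv_lhs => rw [← h.u_mul_rowSum_mul_star_u i]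
    rw [mul_assoc, h.star_u_mul_u, mul_assoc, hr]
  rw [defect, mul_sub, sub_mul, h.u_mul_p, h.p_mul_u, this]

end ToeplitzRelations

end Katsura

/-! ### Operators on vector-valued square-summable families -/

section TensorOp

variable {X : Type*} {H : Type*} [NormedAddCommGroup H] [InnerProductSpace ℂ H]

/-- Pulling a family of nonnegative numbers back along a partial bijection does not increase its
sum. -/
theorem PEquiv.sum_elim_symm_le (F : X ≃. X) (s : Finset X) (k : X → ℝ) (hk : ∀ x, 0 ≤ k x) :
    ∃ t : Finset X, ∑ x ∈ s, (F.symm x).elim 0 k ≤ ∑ y ∈ t, k y := by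
  classical
  refine ⟨s.biUnion fun x => (F.symm x).toFinset, ?_⟩
  set t := s.biUnion fun x => (F.symm x).toFinset with ht
  have h1 : ∀ x ∈ s, (F.symm x).elim 0 k = ∑ y ∈ t, if F y = some x then k y else 0 := by
    intro x hx
    have hF : ∀ y, F y = some x ↔ F.symm x = some y := fun y => (F.eq_some_iff).symm
    simp only [hF]
    cases hy : F.symm x with
    | none => simp
    | some z =>
      have hz : z ∈ t := by
        rw [ht, Finset.mem_biUnion]
        exact ⟨x, hx, by simp [hy]⟩
      simp [hz]
  rw [Finset.sum_congr rfl h1, Finset.sum_comm]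
  refine Finset.sum_le_sum fun y _ => ?_
  cases hy : F y with
  | none => simpa using hk y
  | some z =>
    simp only [Option.some.injEq, Finset.sum_ite_eq]
    split_ifs
    · exact le_rfl
    · exact hk y

theorem tensorOp_bound (F : X ≃. X) (a : H →L[ℂ] H) (v : lp (fun _ : X => H) 2) (s : Finset X) :
    ∑ x ∈ s, ‖(F.symm x).elim 0 fun y => a (v y)‖ ^ (2 : ENNReal).toReal ≤
      (‖a‖ * ‖v‖) ^ (2 : ENNReal).toReal := by
  obtain ⟨t, ht⟩ := F.sum_elim_symm_le s (fun y => ‖a (v y)‖ ^ (2 : ENNReal).toReal)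
    fun _ => by positivity
  have h2 : 0 < (2 : ENNReal).toReal := by norm_num
  calc _ = ∑ x ∈ s, (F.symm x).elim 0 fun y => ‖a (v y)‖ ^ (2 : ENNReal).toReal := by
        refine Finset.sum_congr rfl fun x _ => ?_
        cases F.symm x <;> simp
    _ ≤ ∑ y ∈ t, ‖a (v y)‖ ^ (2 : ENNReal).toReal := ht
    _ ≤ ∑ y ∈ t, ‖a‖ ^ (2 : ENNReal).toReal * ‖v y‖ ^ (2 : ENNReal).toReal := by
        refine Finset.sum_le_sum fun y _ => ?_
        rw [← Real.mul_rpow (norm_nonneg _) (norm_nonneg _)]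
        exact Real.rpow_le_rpow (norm_nonneg _) (a.le_opNorm _) h2.le
    _ ≤ _ := by
        rw [← Finset.mul_sum, Real.mul_rpow (norm_nonneg _) (norm_nonneg _)]
        exact mul_le_mul_of_nonneg_left (lp.sum_rpow_le_norm_rpow h2 v t) (by positivity)

/-- The operator `F ⊗ a` on `ℓ²(X, H) = ℓ²(X) ⊗ H`, for a partial bijection `F` of `X`, which maps
`δ_x ⊗ h` to `δ_{F x} ⊗ a h`, or to `0` where `F` is undefined. -/
noncomputable def tensorOp (F : X ≃. X) (a : H →L[ℂ] H) :
    lp (fun _ : X => H) 2 →L[ℂ] lp (fun _ : X => H) 2 :=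
  LinearMap.mkContinuous
    { toFun := fun v => ⟨fun x => (F.symm x).elim 0 fun y => a (v y),
        memℓp_gen' (tensorOp_bound F a v)⟩
      map_add' := fun v w => lp.ext (funext fun x => by
        change (F.symm x).elim 0 (fun y => a (v y + w y)) =
          (F.symm x).elim 0 (fun y => a (v y)) + (F.symm x).elim 0 (fun y => a (w y))
        cases F.symm x <;> simp)
      map_smul' := fun c v => lp.ext (funext fun x => by
        change (F.symm x).elim 0 (fun y => a (c • v y)) =
          c • (F.symm x).elim 0 (fun y => a (v y))
        cases F.symm x <;> simp) }
    ‖a‖ fun v => lp.norm_le_of_forall_sum_le (by norm_num) (by positivity) (tensorOp_bound F a v)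

theorem tensorOp_apply (F : X ≃. X) (a : H →L[ℂ] H) (v : lp (fun _ : X => H) 2) (x : X) :
    tensorOp F a v x = (F.symm x).elim 0 fun y => a (v y) := rfl

theorem tensorOp_mul (F G : X ≃. X) (a b : H →L[ℂ] H) :
    tensorOp F a * tensorOp G b = tensorOp (G.trans F) (a * b) := by
  ext v x
  change tensorOp F a (tensorOp G b v) x = _
  rw [tensorOp_apply, tensorOp_apply, PEquiv.symm_trans_rev, PEquiv.trans]
  change _ = ((F.symm x).bind G.symm).elim 0 _
  cases F.symm x with
  | none => rfl
  | some y =>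
    change a (tensorOp G b v y) = _
    rw [tensorOp_apply]
    change _ = (G.symm y).elim 0 _
    cases G.symm y with
    | none => simp
    | some z => rfl

theorem tensorOp_sub (F : X ≃. X) (a b : H →L[ℂ] H) :
    tensorOp F (a - b) = tensorOp F a - tensorOp F b := by
  ext v x
  change tensorOp F (a - b) v x = tensorOp F a v x - tensorOp F b v x
  simp only [tensorOp_apply]
  cases F.symm x <;> simp

theorem tensorOp_zero (F : X ≃. X) : tensorOp F (0 : H →L[ℂ] H) = 0 := by
  rw [← sub_zero (0 : H →L[ℂ] H), tensorOp_sub, sub_self]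

theorem tensorOp_bot (a : H →L[ℂ] H) : tensorOp (⊥ : X ≃. X) a = 0 := by
  ext v x
  rw [tensorOp_apply]
  rfl

theorem tensorOp_single [DecidableEq X] (F : X ≃. X) (a : H →L[ℂ] H) (x : X) (h : H) :
    tensorOp F a (lp.single 2 x h) = (F x).elim 0 fun y => lp.single 2 y (a h) := by
  ext y
  rw [tensorOp_apply]
  cases hx : F x with
  | none =>
    cases hy : F.symm y with
    | none => rfl
    | some z =>
      have hz : z ≠ x := by
        rintro rfl
        rw [PEquiv.eq_some_iff, hx] at hy
        exact absurd hy (by simp)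
      simp [hz]
  | some w =>
    cases hy : F.symm y with
    | none =>
      have hw : y ≠ w := by
        rintro rfl
        rw [← PEquiv.eq_some_iff, hy] at hx
        exact absurd hx (by simp)
      simp [hw]
    | some z =>
      rw [PEquiv.eq_some_iff] at hy
      by_cases hz : z = x
      · subst hz
        obtain rfl : w = y := by rw [hx] at hy; exact Option.some.inj hy
        simp
      · have hw : y ≠ w := by
          rintro rfl
          exact hz (F.inj hy hx)
        simp [hw, hz]

theorem star_tensorOp [CompleteSpace H] (F : X ≃. X) (a : H →L[ℂ] H) :
    star (tensorOp F a) = tensorOp F.symm (star a) := by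
  classical
  refine ContinuousLinearMap.ext fun v => lp.ext (funext fun x => ext_inner_left ℂ fun h => ?_)
  have h1 := fun w => lp.inner_single_left (𝕜 := ℂ) (G := fun _ : X => H) x h w
  rw [← h1, ContinuousLinearMap.star_eq_adjoint, ContinuousLinearMap.adjoint_inner_right,
    tensorOp_single, tensorOp_apply, PEquiv.symm_symm]
  cases F x with
  | none => simp
  | some y =>
    change inner ℂ (lp.single 2 y (a h)) v = inner ℂ h (star a (v y))
    rw [lp.inner_single_left, ContinuousLinearMap.star_eq_adjoint,
      ContinuousLinearMap.adjoint_inner_right]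

end TensorOp

/-! ### Positive functionals separate points -/

section PositiveFunctionals

open scoped ComplexOrder

/-- A positive functional that does not vanish at `a`. A real functional which separates `-a` from
the cone of positive elements is composed with the real part and extended complex linearly. -/
theorem exists_positiveLinearMap_apply_ne_zero {D : Type*} [NonUnitalCStarAlgebra D]
    [PartialOrder D] [StarOrderedRing D] {a : D} (ha : 0 ≤ a) (h0 : a ≠ 0) :
    ∃ f : D →ₚ[ℂ] ℂ, f a ≠ 0 := by
  let K : ProperCone ℝ D :=
    { carrier := {x | 0 ≤ x}
      add_mem' := fun hx hy => add_nonneg hx hy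
      zero_mem' := le_rfl
      smul_mem' := fun c x hx => smul_nonneg c.2 hx
      isClosed' := CStarAlgebra.isClosed_nonneg }
  have hK : -a ∉ K := by
    intro h
    have h' : 0 ≤ -a := h
    exact h0 (le_antisymm (neg_nonneg.1 h') ha)
  obtain ⟨g, hg, hga⟩ := K.hyperplane_separation_point hK
  let r : Module.Dual ℝ D :=
    (g : D →ₗ[ℝ] ℝ) ∘ₗ (selfAdjoint.submodule ℝ D).subtype ∘ₗ (realPart : D →ₗ[ℝ] selfAdjoint D)
  have hr : ∀ x, r x = g (realPart x : D) := fun _ => rfl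
  -- On a self-adjoint `x` the extension is real, as `I • x` has real part zero.
  have hext : ∀ x, IsSelfAdjoint x → r.extendRCLike (𝕜 := ℂ) x = (g x : ℂ) := by
    intro x hx
    rw [Module.Dual.extendRCLike_apply, hr, hr]
    have : realPart (RCLike.I (K := ℂ) • x) = 0 := by
      change realPart (Complex.I • x) = 0
      rw [realPart_I_smul, hx.imaginaryPart, neg_zero]
    rw [this, hx.coe_realPart]
    simp
  refine ⟨PositiveLinearMap.mk₀ (r.extendRCLike (𝕜 := ℂ)) fun x hx => ?_, ?_⟩
  · rw [hext x (IsSelfAdjoint.of_nonneg hx)]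
    exact Complex.zero_le_real.2 (hg x hx)
  · change r.extendRCLike (𝕜 := ℂ) a ≠ 0
    rw [hext a (IsSelfAdjoint.of_nonneg ha)]
    rw [map_neg] at hga
    exact_mod_cast (by linarith : (0:ℝ) < g a).ne'

end PositiveFunctionals

/-! ### The unilateral shift and annihilators of the defect projections -/

/-- Induction on the elements of a universal C*-algebra: a closed condition, stable under linear
combinations and products, need only be checked on the generators and their adjoints. -/
theorem UniversalCStar.Alg.induction {G : Type u} (R : UniversalCStar.Relations G)
    {P : UniversalCStar.Alg R → Prop} (gen : ∀ g, P (UniversalCStar.gen R g))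
    (star_gen : ∀ g, P (star (UniversalCStar.gen R g))) (zero : P 0)
    (add : ∀ x y, P x → P y → P (x + y)) (smul : ∀ (c : ℂ) x, P x → P (c • x))
    (mul : ∀ x y, P x → P y → P (x * y)) (closed : IsClosed {x | P x}) (x) : P x := by
  let S : NonUnitalStarSubalgebra ℂ (UniversalCStar.Alg R) :=
    { carrier := {x | P x ∧ P (star x)}
      add_mem' := fun hx hy => ⟨add _ _ hx.1 hy.1, by rw [star_add]; exact add _ _ hx.2 hy.2⟩
      zero_mem' := ⟨zero, by rwa [star_zero]⟩
      mul_mem' := fun hx hy => ⟨mul _ _ hx.1 hy.1, by rw [star_mul]; exact mul _ _ hy.2 hx.2⟩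
      smul_mem' := fun c x hx => ⟨smul c x hx.1, by rw [star_smul]; exact smul _ _ hx.2⟩
      star_mem' := fun hx => ⟨hx.2, by rw [star_star]; exact hx.1⟩ }
  have hle : UniversalCStar.gensub (UniversalCStar.gen R) ≤ S :=
    UniversalCStar.gensub_le _ (closed.inter (closed.preimage continuous_star))
      fun g => ⟨gen g, star_gen g⟩
  rw [UniversalCStar.gensub_gen] at hle
  exact (hle (show x ∈ ⊤ from trivial)).1

/-- The map `n ↦ n + 1` as a partial bijection of `ℕ`; as an operator on `ℓ²(ℕ)` it is the
unilateral shift. -/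
def shift : ℕ ≃. ℕ where
  toFun n := some (n + 1)
  invFun
    | 0 => none
    | n + 1 => some n
  inv a b := by cases b <;> simp [eq_comm]

theorem shift_trans_symm : shift.trans shift.symm = PEquiv.refl ℕ := by
  ext x y
  simp [shift, PEquiv.trans, PEquiv.symm, PEquiv.refl]

namespace Katsura

variable {ι : Type u} {A B : ι → ι →₀ ℤ}

theorem ToeplitzRelations.map {C D : Type*} [NonUnitalCStarAlgebra C] [NonUnitalCStarAlgebra D]
    {f : Gen A → C} (h : ToeplitzRelations A B f) (φ : C →⋆ₙₐ[ℂ] D) :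
    ToeplitzRelations A B fun g => φ (f g) where
  isStarProjection i := (h.isStarProjection i).map φ
  orthogonal i j hij := by rw [← map_mul, h.orthogonal i j hij, map_zero]
  star_u_mul_u i := by rw [← map_star, ← map_mul, h.star_u_mul_u]
  u_mul_star_u i := by rw [← map_star, ← map_mul, h.u_mul_star_u]
  partialIsometry i j hij n := by rw [← map_star, ← map_mul, ← map_mul, h.partialIsometry]
  s_mul_u i j hij n := by rw [← map_mul, h.s_mul_u]
  u_mul_s i j hij n := by rw [← map_mul, h.u_mul_s]
  star_s_mul_s i j hij n := by rw [← map_star, ← map_mul, h.star_s_mul_s]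
  rowSum_le i := by rw [← map_rowSum, ← map_sub]; exact (h.rowSum_le i).map φ

/-- The isometry `h ↦ (N + 1)^{-1/2} ∑_{k ≤ N} δ_k ⊗ h`, whose range is almost invariant under the
shift for large `N`. -/
noncomputable def averaging (H : Type*) [NormedAddCommGroup H] [InnerProductSpace ℂ H] (N : ℕ) :
    H →L[ℂ] lp (fun _ : ℕ => H) 2 :=
  ((√(N + 1 : ℝ))⁻¹ : ℂ) • ∑ k ∈ Finset.range (N + 1),
    lp.singleContinuousLinearMap ℂ (fun _ : ℕ => H) 2 k

theorem averaging_apply {H : Type*} [NormedAddCommGroup H] [InnerProductSpace ℂ H] (N : ℕ)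
    (h : H) : averaging H N h = ((√(N + 1 : ℝ))⁻¹ : ℂ) •
      ∑ k ∈ Finset.range (N + 1), (lp.single 2 k h : lp (fun _ : ℕ => H) 2) := by
  simp [averaging]

theorem norm_averaging {H : Type*} [NormedAddCommGroup H] [InnerProductSpace ℂ H] (N : ℕ)
    (h : H) : ‖averaging H N h‖ = ‖h‖ := by
  have h1 := lp.norm_sum_single (E := fun _ : ℕ => H) (p := 2) (by norm_num) (fun _ => h)
    (Finset.range (N + 1))
  simp only [ENNReal.toReal_ofNat, Real.rpow_ofNat, Finset.sum_const, Finset.card_range,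
    nsmul_eq_mul] at h1
  have h2 : (0 : ℝ) < √(N + 1 : ℝ) := by positivity
  have h3 : ‖∑ k ∈ Finset.range (N + 1), (lp.single 2 k h : lp (fun _ : ℕ => H) 2)‖ =
      √(N + 1 : ℝ) * ‖h‖ := by
    rw [← sq_eq_sq₀ (norm_nonneg _) (by positivity), h1, mul_pow, Real.sq_sqrt (by positivity)]
    push_cast; ring
  rw [averaging_apply, norm_smul, h3, norm_inv, Complex.norm_real, Real.norm_of_nonneg h2.le]
  field_simp

theorem tendsto_averaging_error {E : Type*} [NormedAddCommGroup E] [NormedSpace ℂ E] (e : ℕ → E)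
    (c : ℝ) (he : ∀ N, ‖e N‖ ≤ c) :
    Filter.Tendsto (fun N : ℕ => ((√(N + 1 : ℝ))⁻¹ : ℂ) • e N) Filter.atTop (nhds 0) := by
  have h1 : Filter.Tendsto (fun N : ℕ => (√(N + 1 : ℝ))⁻¹ * c) Filter.atTop (nhds 0) := by
    have h2 : Filter.Tendsto (fun N : ℕ => (N : ℝ) + 1) Filter.atTop Filter.atTop :=
      Filter.tendsto_atTop_add_const_right _ _ tendsto_natCast_atTop_atTop
    simpa using (tendsto_inv_atTop_zero.comp (Real.tendsto_sqrt_atTop.comp h2)).mul_const c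
  refine squeeze_zero_norm (fun N => ?_) h1
  rw [norm_smul, norm_inv, Complex.norm_real, Real.norm_of_nonneg (Real.sqrt_nonneg _)]
  exact mul_le_mul_of_nonneg_left (he N) (by positivity)

section Shift

variable {H : Type*} [NormedAddCommGroup H] [InnerProductSpace ℂ H] [CompleteSpace H]

/-- The family on `ℓ²(ℕ) ⊗ H` obtained from a family on `H` by tensoring each `s_{i,j,n}` with the
unilateral shift, and each `p_i` and `u_i` with the identity. -/
noncomputable def shiftFamily (f : Gen A → (H →L[ℂ] H)) :
    Gen A → (lp (fun _ : ℕ => H) 2 →L[ℂ] lp (fun _ : ℕ => H) 2)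
  | .p i => tensorOp (PEquiv.refl ℕ) (f (.p i))
  | .u i => tensorOp (PEquiv.refl ℕ) (f (.u i))
  | .s i j h n => tensorOp shift (f (.s i j h n))

/-- With the shift tensored on, the sum in the relations becomes `q_i ⊗ S S*`, where `q_i` is the
sum for `f`; it is still dominated by `p_i ⊗ 1`. -/
theorem shiftFamily_relations {f : Gen A → (H →L[ℂ] H)} (h : ToeplitzRelations A B f) :
    ToeplitzRelations A B (shiftFamily f) := by
  have hb : BaseRelations A B (shiftFamily f) :=
    { isStarProjection := fun i =>
        { isIdempotentElem := by
            simp only [IsIdempotentElem, shiftFamily, tensorOp_mul, PEquiv.refl_trans, h.p_mul_p]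
          isSelfAdjoint := by
            simp only [IsSelfAdjoint, shiftFamily, star_tensorOp, PEquiv.symm_refl, h.star_p] }
      orthogonal := fun i j hij => by
        simp only [shiftFamily, tensorOp_mul, PEquiv.refl_trans, h.orthogonal i j hij,
          tensorOp_zero]
      star_u_mul_u := fun i => by
        simp only [shiftFamily, star_tensorOp, PEquiv.symm_refl, tensorOp_mul, PEquiv.refl_trans,
          h.star_u_mul_u]
      u_mul_star_u := fun i => by
        simp only [shiftFamily, star_tensorOp, PEquiv.symm_refl, tensorOp_mul, PEquiv.refl_trans,
          h.u_mul_star_u]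
      partialIsometry := fun i j hij n => by
        simp only [shiftFamily, star_tensorOp, tensorOp_mul, ← PEquiv.trans_assoc,
          shift_trans_symm, PEquiv.refl_trans, h.partialIsometry]
      s_mul_u := fun i j hij n => by
        simp only [shiftFamily, tensorOp_mul, PEquiv.refl_trans, h.s_mul_u]
      u_mul_s := fun i j hij n => by
        simp only [shiftFamily, tensorOp_mul, PEquiv.trans_refl, h.u_mul_s]
      star_s_mul_s := fun i j hij n => by
        simp only [shiftFamily, star_tensorOp, tensorOp_mul, shift_trans_symm, h.star_s_mul_s] }
  refine hb.toeplitz fun i j k hij hik n hn m hm hne => ?_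
  simp only [shiftFamily, star_tensorOp, tensorOp_mul,
    h.star_s_mul_s_of_mem i j k hij hik n m hn hm hne, tensorOp_zero]

/-- On the ranges of the averaging isometries, `x` acts asymptotically in the same way as it does
on `H`. -/
theorem tendsto_averaging (π : TAlg A B →⋆ₙₐ[ℂ] (H →L[ℂ] H))
    (Ψ : TAlg A B →⋆ₙₐ[ℂ] (lp (fun _ : ℕ => H) 2 →L[ℂ] lp (fun _ : ℕ => H) 2))
    (hΨ : ∀ g, Ψ (tGen A B g) = shiftFamily (fun g => π (tGen A B g)) g) (x : TAlg A B) :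
    ∀ h, Filter.Tendsto (fun N => Ψ x (averaging H N h) - averaging H N (π x h)) Filter.atTop
      (nhds 0) := by
  have hrefl : ∀ (a : H →L[ℂ] H) N h, tensorOp (PEquiv.refl ℕ) a (averaging H N h) =
      averaging H N (a h) := by
    intro a N h
    simp only [averaging_apply, map_smul, map_sum, tensorOp_single]
    rfl
  induction x using UniversalCStar.Alg.induction with
  | gen g =>
    intro h
    rw [show UniversalCStar.gen (toeplitzRel A B) g = tGen A B g from rfl, hΨ]
    rcases g with i | i | ⟨i, j, hij, n⟩
    · simp [shiftFamily, hrefl]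
    · simp [shiftFamily, hrefl]
    · set a := π (tGen A B (.s i j hij n))
      have : ∀ N, tensorOp shift a (averaging H N h) - averaging H N (a h) =
          ((√(N + 1 : ℝ))⁻¹ : ℂ) • ((lp.single 2 (N + 1) (a h) : lp (fun _ : ℕ => H) 2) -
            lp.single 2 0 (a h)) := by
        intro N
        simp only [averaging_apply, map_smul, map_sum, tensorOp_single, ← smul_sub,
          ← Finset.sum_sub_distrib]
        rw [← Finset.sum_range_sub (fun k => (lp.single 2 k (a h) : lp (fun _ : ℕ => H) 2))]
        rfl
      simp only [shiftFamily]
      change Filter.Tendsto (fun N => tensorOp shift a (averaging H N h) - averaging H N (a h)) _ _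
      simp only [this]
      refine tendsto_averaging_error _ (‖a h‖ + ‖a h‖) fun N => (norm_sub_le _ _).trans ?_
      rw [lp.norm_single (by norm_num), lp.norm_single (by norm_num)]
  | star_gen g =>
    intro h
    rw [show UniversalCStar.gen (toeplitzRel A B) g = tGen A B g from rfl, map_star, map_star, hΨ]
    rcases g with i | i | ⟨i, j, hij, n⟩
    · simp [shiftFamily, star_tensorOp, hrefl]
    · simp [shiftFamily, star_tensorOp, hrefl]
    · set a := π (tGen A B (.s i j hij n))
      have : ∀ N, tensorOp shift.symm (star a) (averaging H N h) - averaging H N (star a h) =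
          ((√(N + 1 : ℝ))⁻¹ : ℂ) • -(lp.single 2 N (star a h) : lp (fun _ : ℕ => H) 2) := by
        intro N
        simp only [averaging_apply, map_smul, map_sum, tensorOp_single, ← smul_sub]
        rw [Finset.sum_range_succ', Finset.sum_range_succ _ N]
        congr 1
        change (∑ k ∈ Finset.range N, (lp.single 2 k (star a h) : lp (fun _ : ℕ => H) 2)) + 0 -
          _ = _
        abel
      simp only [shiftFamily, star_tensorOp]
      change Filter.Tendsto (fun N => tensorOp shift.symm (star a) (averaging H N h) -
        averaging H N (star a h)) _ _
      simp only [this]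
      refine tendsto_averaging_error _ ‖star a h‖ fun N => ?_
      rw [norm_neg, lp.norm_single (by norm_num)]
  | zero => intro h; simp
  | add x y hx hy =>
    intro h
    have := (hx h).add (hy h)
    rw [add_zero] at this
    refine this.congr fun N => ?_
    simp only [map_add, _root_.add_apply]
    abel
  | smul c x hx =>
    intro h
    have := (hx h).const_smul c
    rw [smul_zero] at this
    refine this.congr fun N => ?_
    simp [smul_sub]
  | mul x y hx hy =>
    intro h
    have h1 := ((Ψ x).continuous.tendsto 0).comp (hy h)
    rw [map_zero] at h1
    have := h1.add (hx (π y h))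
    rw [add_zero] at this
    refine this.congr fun N => ?_
    simp [map_sub]
  | closed =>
    have key : ∀ y N h, ‖Ψ y (averaging H N h) - averaging H N (π y h)‖ ≤ 2 * ‖y‖ * ‖h‖ := by
      intro y N h
      have h1 : ‖Ψ y (averaging H N h)‖ ≤ ‖y‖ * ‖h‖ := by
        refine ((Ψ y).le_opNorm _).trans ?_
        rw [norm_averaging]
        exact mul_le_mul_of_nonneg_right (NonUnitalStarAlgHom.norm_apply_le Ψ y) (norm_nonneg _)
      have h2 : ‖averaging H N (π y h)‖ ≤ ‖y‖ * ‖h‖ := by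
        rw [norm_averaging]
        refine ((π y).le_opNorm _).trans ?_
        exact mul_le_mul_of_nonneg_right (NonUnitalStarAlgHom.norm_apply_le π y) (norm_nonneg _)
      linarith [norm_sub_le (Ψ y (averaging H N h)) (averaging H N (π y h))]
    refine isClosed_of_closure_subset fun x hx h => ?_
    rw [Metric.tendsto_atTop]
    intro ε hε
    obtain ⟨y, hy, hxy⟩ := Metric.mem_closure_iff.1 hx (ε / (4 * (‖h‖ + 1))) (by positivity)
    obtain ⟨N₀, hN₀⟩ := Metric.tendsto_atTop.1 (hy h) (ε / 2) (by positivity)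
    refine ⟨N₀, fun N hN => ?_⟩
    have h1 := hN₀ N hN
    rw [dist_zero_right] at h1 ⊢
    have h2 := key (x - y) N h
    rw [dist_eq_norm] at hxy
    have h3 : 2 * ‖x - y‖ * ‖h‖ ≤ ε / 2 := by
      have : ‖x - y‖ * (4 * (‖h‖ + 1)) < ε := (lt_div_iff₀ (by positivity)).1 hxy
      nlinarith [norm_nonneg (x - y), norm_nonneg h]
    have h4 : Ψ x (averaging H N h) - averaging H N (π x h) =
        (Ψ y (averaging H N h) - averaging H N (π y h)) +
          (Ψ (x - y) (averaging H N h) - averaging H N (π (x - y) h)) := by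
      simp only [map_sub, _root_.sub_apply]
      abel
    rw [h4]
    linarith [norm_add_le (Ψ y (averaging H N h) - averaging H N (π y h))
      (Ψ (x - y) (averaging H N h) - averaging H N (π (x - y) h))]

/-- The vector `δ_n ⊗ h` is pushed down to level `n - 1` by `x p_i = ∑ (x s) s*`, and the vectors at
level zero are killed by the adjoint of the shift. -/
theorem apply_single_eq_zero (f : Gen A → (H →L[ℂ] H))
    (Ψ : TAlg A B →⋆ₙₐ[ℂ] (lp (fun _ : ℕ => H) 2 →L[ℂ] lp (fun _ : ℕ => H) 2))
    (hΨ : ∀ g, Ψ (tGen A B g) = shiftFamily f g) (I : TwoSidedIdeal (TAlg A B))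
    (hI : ∀ x ∈ I, ∀ j, x * defect A (tGen A B) j = 0) (n : ℕ) :
    ∀ x ∈ I, ∀ i h, Ψ (x * tGen A B (.p i)) (lp.single 2 n h) = 0 := by
  have hT := tGen_relations A B
  have hx' : ∀ x ∈ I, ∀ i, x * tGen A B (.p i) = x * rowSum A (tGen A B) i 0 := by
    intro x hx i
    have := hI x hx i
    rw [defect, mul_sub, sub_eq_zero] at this
    exact this
  induction n with
  | zero =>
    intro x hx i h
    rw [hx' x hx, rowSum_zero, Finset.mul_sum, map_sum, _root_.sum_apply]
    refine Finset.sum_eq_zero fun k _ => ?_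
    rw [map_mul, map_mul, map_star, hΨ]
    simp only [shiftFamily, star_tensorOp]
    change Ψ x (tensorOp shift _ (tensorOp shift.symm _ (lp.single 2 0 h))) = 0
    rw [tensorOp_single]
    change Ψ x (tensorOp shift _ 0) = 0
    simp
  | succ n ih =>
    intro x hx i h
    rw [hx' x hx, rowSum_zero, Finset.mul_sum, map_sum, _root_.sum_apply]
    refine Finset.sum_eq_zero fun k _ => ?_
    rw [← mul_assoc, map_mul, map_star]
    conv_lhs => rw [hΨ]
    simp only [shiftFamily, star_tensorOp]
    change Ψ _ (tensorOp shift.symm _ (lp.single 2 (n + 1) h)) = 0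
    rw [tensorOp_single]
    have := ih _ (I.mul_mem_right x (tGen A B (.s i k.1 (mem_omegaRow.1 k.1.2) k.2)) hx) k.1
      (star (f (.s i k.1 (mem_omegaRow.1 k.1.2) k.2)) h)
    rw [mul_assoc, hT.s_mul_p] at this
    exact this

end Shift

/-- An ideal of `𝒯_{A,B}` which annihilates all the defect projections is zero. If `π` is a
representation on `H`, then in the representation `Ψ` on `ℓ²(ℕ) ⊗ H` given by `shiftFamily`, the
translates of the range of the defect projections under products of the `s_{i,j,n}` already span
everything, so `Ψ` vanishes on the ideal; and `Ψ` has `π` as an asymptotic compression. -/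
theorem eq_bot_of_mul_defect_eq_zero (I : TwoSidedIdeal (TAlg A B))
    (hI : ∀ x ∈ I, ∀ j, x * defect A (tGen A B) j = 0) : I = ⊥ := by
  have hT := tGen_relations A B
  have hp : ∀ x ∈ I, ∀ i, x * tGen A B (.p i) = 0 := by
    intro x hx i
    by_contra hne
    set y := x * tGen A B (.p i) with hy
    have hyI : y ∈ I := I.mul_mem_right _ _ hx
    have hyp : y * tGen A B (.p i) = y := by rw [hy, mul_assoc, hT.p_mul_p]
    let _ := CStarAlgebra.spectralOrder (TAlg A B)
    let _ := CStarAlgebra.spectralOrderedRing (TAlg A B)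
    obtain ⟨ω, hω⟩ := exists_positiveLinearMap_apply_ne_zero (star_mul_self_nonneg y)
      (fun h => hne ((CStarRing.star_mul_self_eq_zero_iff _).1 h))
    -- The vector of `p_i` in this representation is not killed by `y`, because `y p_i = y`.
    let π := ω.gnsNonUnitalStarAlgHom
    obtain ⟨Ψ, hΨ, -⟩ := TAlg.existsUnique_hom A B _ (shiftFamily_relations (hT.map π))
    have h0 : ∀ h, π y h = 0 := by
      intro h
      have h1 := tendsto_averaging π Ψ hΨ y h
      have h2 : ∀ N, Ψ y (averaging _ N h) = 0 := by
        intro N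
        rw [averaging_apply, map_smul, map_sum, Finset.sum_eq_zero, smul_zero]
        intro k _
        rw [← hyp]
        exact apply_single_eq_zero _ Ψ hΨ I hI k y hyI i h
      have h3 := h1.norm
      simp only [h2, zero_sub, norm_neg, norm_averaging, norm_zero] at h3
      exact norm_eq_zero.1 (tendsto_nhds_unique tendsto_const_nhds h3)
    have h1 := h0 (ω.toPreGNS (tGen A B (.p i)) : ω.GNS)
    rw [PositiveLinearMap.gnsNonUnitalStarAlgHom_apply_coe] at h1
    have h2 : ‖ω.toPreGNS y‖ = 0 := by
      rw [← UniformSpace.Completion.norm_coe, ← hyp]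
      exact norm_eq_zero.2 h1
    apply hω
    have h3 := ω.preGNS_norm_sq (ω.toPreGNS y)
    rw [h2] at h3
    simpa using h3.symm
  rw [eq_bot_iff]
  intro x hx
  have hxz : ∀ z, x * z = 0 := by
    intro z
    induction z using UniversalCStar.Alg.induction with
    | gen g =>
      rcases g with i | i | ⟨i, j, hij, n⟩
      · exact hp x hx i
      · change x * tGen A B _ = 0
        rw [← hT.p_mul_u, ← mul_assoc, hp x hx, zero_mul]
      · change x * tGen A B _ = 0
        rw [← hT.p_mul_s, ← mul_assoc, hp x hx, zero_mul]
    | star_gen g =>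
      rcases g with i | i | ⟨i, j, hij, n⟩
      · change x * star (tGen A B _) = 0
        rw [hT.star_p, hp x hx]
      · change x * star (tGen A B _) = 0
        rw [← hT.p_mul_star_u, ← mul_assoc, hp x hx, zero_mul]
      · change x * star (tGen A B _) = 0
        rw [← hT.p_mul_star_s, ← mul_assoc, hp x hx, zero_mul]
    | zero => exact mul_zero x
    | add y z hy hz => rw [mul_add, hy, hz, add_zero]
    | smul c y hy => rw [mul_smul_comm, hy, smul_zero]
    | mul y z hy hz => rw [← mul_assoc, hy, zero_mul]
    | closed => exact isClosed_eq (continuous_const.mul continuous_id) continuous_const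
  exact (TwoSidedIdeal.mem_bot _).2 ((CStarRing.mul_star_self_eq_zero_iff x).1 (hxz (star x)))

end Katsura

namespace Katsura

variable {ι : Type u} {A B : ι → ι →₀ ℤ}

/-! ### Corners cut out by the defect projections -/

section Corner

theorem uPrime_eq (j : ι) : uPrime A B j = tGen A B (.u j) * defect A (tGen A B) j :=
  ((tGen_relations A B).u_mul_defect j).symm

theorem star_uPrime (j : ι) :
    star (uPrime A B j) = defect A (tGen A B) j * star (tGen A B (.u j)) := by
  rw [uPrime_eq, star_mul, (tGen_relations A B).star_defect]

theorem star_uPrime_mul_uPrime (j : ι) :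
    star (uPrime A B j) * uPrime A B j = defect A (tGen A B) j := by
  have hT := tGen_relations A B
  rw [star_uPrime, uPrime_eq, mul_assoc, ← mul_assoc (star _), hT.star_u_mul_u, hT.p_mul_defect,
    (hT.defect_isStarProjection j).isIdempotentElem.eq]

theorem uPrime_mul_star_uPrime (j : ι) :
    uPrime A B j * star (uPrime A B j) = defect A (tGen A B) j := by
  have hT := tGen_relations A B
  rw [star_uPrime, uPrime_eq, hT.u_commute_defect, ← mul_assoc, mul_assoc _ _ (defect _ _ _),
    hT.u_commute_defect, ← mul_assoc, (hT.defect_isStarProjection j).isIdempotentElem.eq,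
    mul_assoc, hT.u_mul_star_u, hT.defect_mul_p]

theorem isStarNormal_uPrime (j : ι) : IsStarNormal (uPrime A B j) :=
  ⟨by rw [commute_iff_eq, star_uPrime_mul_uPrime, uPrime_mul_star_uPrime]⟩

theorem defect_mem_elemental (j : ι) :
    defect A (tGen A B) j ∈ NonUnitalStarAlgebra.elemental ℂ (uPrime A B j) := by
  have := NonUnitalStarAlgebra.elemental.self_mem ℂ (uPrime A B j)
  rw [← star_uPrime_mul_uPrime]
  exact mul_mem (star_mem this) this

theorem mul_defect_of_mem_elemental {j : ι} {x : TAlg A B}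
    (hx : x ∈ NonUnitalStarAlgebra.elemental ℂ (uPrime A B j)) :
    x * defect A (tGen A B) j = x := by
  have hT := tGen_relations A B
  set d := defect A (tGen A B) j with hd
  have hds : star d = d := hT.star_defect j
  have hdd : d * d = d := (hT.defect_isStarProjection j).isIdempotentElem
  let S : NonUnitalStarSubalgebra ℂ (TAlg A B) :=
    { carrier := {x | x * d = x ∧ d * x = x}
      add_mem' := fun hx hy => ⟨by rw [add_mul, hx.1, hy.1], by rw [mul_add, hx.2, hy.2]⟩
      zero_mem' := ⟨zero_mul _, mul_zero _⟩
      mul_mem' := fun {a b} hx hy => ⟨by rw [mul_assoc, hy.1], by rw [← mul_assoc, hx.2]⟩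
      smul_mem' := fun c x hx => ⟨by rw [smul_mul_assoc, hx.1], by rw [mul_smul_comm, hx.2]⟩
      star_mem' := fun {a} hx => ⟨by
          have := congrArg star hx.2
          rwa [star_mul, hds] at this, by
          have := congrArg star hx.1
          rwa [star_mul, hds] at this⟩ }
  have hS : IsClosed (S : Set (TAlg A B)) :=
    (isClosed_eq (continuous_id.mul continuous_const) continuous_id).inter
      (isClosed_eq (continuous_const.mul continuous_id) continuous_id)
  have hu : uPrime A B j ∈ S := by
    refine ⟨?_, ?_⟩
    · rw [uPrime_eq, mul_assoc, ← hd, hdd]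
    · rw [uPrime_eq, hT.u_commute_defect, ← mul_assoc, ← hd, hdd]
  exact (NonUnitalStarAlgebra.elemental.le_of_mem hS hu hx).1

variable (A B) in
/-- Zero, and the elements of the form `x s_{e_m}* ⋯ s_{e_1}*`, for a path `e_1 ⋯ e_m` from `i`
to `j` and an element `x` of the C*-algebra generated by `u_j'`. Their closed span is invariant
under right multiplication by `𝒯_{A,B}`. -/
inductive CornerWord (j : ι) : ι → TAlg A B → Prop
  | base (x : TAlg A B) (hx : x ∈ NonUnitalStarAlgebra.elemental ℂ (uPrime A B j)) :
      CornerWord j j x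
  | zero (i : ι) : CornerWord j i 0
  | step (i k : ι) (hik : 1 ≤ A i k) (n : ℤ) (x : TAlg A B) (hx : CornerWord j k x) :
      CornerWord j i (x * star (tGen A B (.s i k hik n)))

namespace CornerWord

theorem mul_p {j i : ι} {x : TAlg A B} (hx : CornerWord A B j i x) :
    x * tGen A B (.p i) = x := by
  have hT := tGen_relations A B
  cases hx with
  | base _ hx => rw [← mul_defect_of_mem_elemental hx, mul_assoc, hT.defect_mul_p]
  | zero => exact zero_mul _
  | step _ k hik n x hx => rw [mul_assoc, hT.star_s_mul_p]

theorem mul_u {j i : ι} {x : TAlg A B} (hx : CornerWord A B j i x) :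
    CornerWord A B j i (x * tGen A B (.u i)) := by
  have hT := tGen_relations A B
  cases hx with
  | base _ hx =>
    refine .base _ ?_
    rw [← mul_defect_of_mem_elemental hx, mul_assoc, ← hT.u_commute_defect, ← uPrime_eq]
    exact mul_mem hx (NonUnitalStarAlgebra.elemental.self_mem ℂ _)
  | zero => rw [zero_mul]; exact .zero _
  | step _ k hik n x hx =>
    have := congrArg star (hT.star_u_mul_s i k hik n)
    rw [star_mul, star_star] at this
    rw [mul_assoc, this]
    exact .step _ _ _ _ _ hx

theorem mul_star_u {j i : ι} {x : TAlg A B} (hx : CornerWord A B j i x) :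
    CornerWord A B j i (x * star (tGen A B (.u i))) := by
  have hT := tGen_relations A B
  cases hx with
  | base _ hx =>
    refine .base _ ?_
    rw [← mul_defect_of_mem_elemental hx, mul_assoc, ← star_uPrime]
    exact mul_mem hx (star_mem (NonUnitalStarAlgebra.elemental.self_mem ℂ _))
  | zero => rw [zero_mul]; exact .zero _
  | step _ k hik n x hx =>
    rw [mul_assoc, ← star_mul, hT.u_mul_s]
    exact .step _ _ _ _ _ hx

theorem mul_star_s_mul_s {j i k : ι} {x : TAlg A B} (hx : CornerWord A B j k x)
    (hik : 1 ≤ A i k) (n l : ℤ) :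
    CornerWord A B j k (x * star (tGen A B (.s i k hik n)) *
      tGen A B (.s i k hik (n + l * A i k))) := by
  have hT := tGen_relations A B
  induction l using Int.induction_on with
  | zero => rw [zero_mul, add_zero, mul_assoc, hT.star_s_mul_s, hx.mul_p]; exact hx
  | succ l ih =>
    have e : n + ((l : ℤ) + 1) * A i k = n + l * A i k + A i k := by ring
    rw [e, ← hT.s_mul_u, ← mul_assoc]
    exact ih.mul_u
  | pred l ih =>
    have e : n + (-(l : ℤ) - 1) * A i k = n + -(l : ℤ) * A i k - A i k := by ring
    rw [e, ← hT.s_mul_star_u, ← mul_assoc]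
    exact ih.mul_star_u

theorem mul_s {j i : ι} {x : TAlg A B} (hx : CornerWord A B j i x) (k : ι) (hik : 1 ≤ A i k)
    (n : ℤ) : CornerWord A B j k (x * tGen A B (.s i k hik n)) := by
  have hT := tGen_relations A B
  cases hx with
  | base _ hx =>
    rw [← mul_defect_of_mem_elemental hx, mul_assoc, hT.defect_mul_s, mul_zero]
    exact .zero _
  | zero => rw [zero_mul]; exact .zero _
  | step _ k' hik' n' x hx =>
    by_cases he : ∃ l : ℤ, k' = k ∧ n = n' + l * A i k'
    · obtain ⟨l, rfl, rfl⟩ := he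
      exact hx.mul_star_s_mul_s hik n' l
    · rw [mul_assoc, hT.star_s_mul_s_eq_zero i k' k hik' hik n' n
        (fun l h1 h2 => he ⟨l, h1, h2⟩), mul_zero]
      exact .zero _

theorem mul_eq_zero_of_ne {j i k : ι} {x y : TAlg A B} (hx : CornerWord A B j i x) (hik : i ≠ k)
    (hy : tGen A B (.p k) * y = y) : x * y = 0 := by
  rw [← hx.mul_p, ← hy, mul_assoc, ← mul_assoc (tGen A B (.p i)),
    (tGen_relations A B).orthogonal i k hik, zero_mul, mul_zero]

theorem exists_mul_gen {j i : ι} {x : TAlg A B} (hx : CornerWord A B j i x) (g : Gen A) :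
    ∃ k, CornerWord A B j k (x * tGen A B g) := by
  have hT := tGen_relations A B
  rcases g with k | k | ⟨k, l, hkl, n⟩ <;> by_cases hik : i = k
  · subst hik; exact ⟨i, by rwa [hx.mul_p]⟩
  · exact ⟨i, by rw [hx.mul_eq_zero_of_ne hik (hT.p_mul_p k)]; exact .zero _⟩
  · subst hik; exact ⟨i, hx.mul_u⟩
  · exact ⟨i, by rw [hx.mul_eq_zero_of_ne hik (hT.p_mul_u k)]; exact .zero _⟩
  · subst hik; exact ⟨l, hx.mul_s l hkl n⟩
  · exact ⟨i, by rw [hx.mul_eq_zero_of_ne hik (hT.p_mul_s k l hkl n)]; exact .zero _⟩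

theorem exists_mul_star_gen {j i : ι} {x : TAlg A B} (hx : CornerWord A B j i x) (g : Gen A) :
    ∃ k, CornerWord A B j k (x * star (tGen A B g)) := by
  have hT := tGen_relations A B
  rcases g with k | k | ⟨l, k, hlk, n⟩
  · rw [hT.star_p]; exact hx.exists_mul_gen _
  · by_cases hik : i = k
    · subst hik; exact ⟨i, hx.mul_star_u⟩
    · exact ⟨i, by rw [hx.mul_eq_zero_of_ne hik (hT.p_mul_star_u k)]; exact .zero _⟩
  · by_cases hik : i = k
    · subst hik; exact ⟨l, .step _ _ _ _ _ hx⟩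
    · exact ⟨i, by rw [hx.mul_eq_zero_of_ne hik (hT.p_mul_star_s l k hlk n)]; exact .zero _⟩

theorem mul_defect_mem {j i : ι} {x : TAlg A B} (hx : CornerWord A B j i x) :
    x * defect A (tGen A B) j ∈ NonUnitalStarAlgebra.elemental ℂ (uPrime A B j) := by
  have hT := tGen_relations A B
  cases hx with
  | base _ hx => rwa [mul_defect_of_mem_elemental hx]
  | zero => rw [zero_mul]; exact zero_mem _
  | step _ k hik n x hx =>
    by_cases hij : i = j
    · subst hij
      rw [mul_assoc, hT.star_s_mul_defect, mul_zero]
      exact zero_mem _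
    · rw [mul_assoc, ← hT.star_s_mul_p, mul_assoc, hT.p_mul_defect_of_ne hij, mul_zero, mul_zero]
      exact zero_mem _

end CornerWord

/-- The corner of `𝒯_{A,B}` at the `j`-th defect projection is generated by `u_j'`. -/
theorem defect_mul_mul_defect_mem (j : ι) (z : TAlg A B) :
    defect A (tGen A B) j * z * defect A (tGen A B) j ∈
      NonUnitalStarAlgebra.elemental ℂ (uPrime A B j) := by
  let M : Submodule ℂ (TAlg A B) :=
    (Submodule.span ℂ {x | ∃ i, CornerWord A B j i x}).topologicalClosure
  have hMc : IsClosed (M : Set (TAlg A B)) := Submodule.isClosed_topologicalClosure _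
  have hsub : ∀ i x, CornerWord A B j i x → x ∈ M := fun i x hx =>
    Submodule.le_topologicalClosure _ (Submodule.subset_span ⟨i, hx⟩)
  have hgen : ∀ y : TAlg A B, (∀ i x, CornerWord A B j i x → x * y ∈ M) → ∀ x ∈ M, x * y ∈ M := by
    intro y hy
    have hle : M ≤ M.comap (LinearMap.mulRight ℂ y) := by
      refine Submodule.topologicalClosure_minimal _ (Submodule.span_le.2 ?_)
        (hMc.preimage (continuous_id.mul continuous_const))
      rintro x ⟨i, hx⟩
      exact hy i x hx
    exact fun x hx => hle hx
  have hM : ∀ x ∈ M, x * z ∈ M := by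
    induction z using UniversalCStar.Alg.induction with
    | gen g =>
      refine hgen _ fun i x hx => ?_
      obtain ⟨k, hk⟩ := hx.exists_mul_gen g
      exact hsub k _ hk
    | star_gen g =>
      refine hgen _ fun i x hx => ?_
      obtain ⟨k, hk⟩ := hx.exists_mul_star_gen g
      exact hsub k _ hk
    | zero => intro x _; rw [mul_zero]; exact M.zero_mem
    | add y z hy hz => intro x hx; rw [mul_add]; exact M.add_mem (hy x hx) (hz x hx)
    | smul c y hy => intro x hx; rw [mul_smul_comm]; exact M.smul_mem c (hy x hx)
    | mul y z hy hz => intro x hx; rw [← mul_assoc]; exact hz _ (hy x hx)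
    | closed =>
      simp only [Set.ofPred_forall]
      exact isClosed_iInter fun x => isClosed_iInter fun _ =>
        hMc.preimage (continuous_const.mul continuous_id)
  have hle : M ≤ (NonUnitalStarAlgebra.elemental ℂ (uPrime A B j)).toSubmodule.comap
      (LinearMap.mulRight ℂ (defect A (tGen A B) j)) := by
    refine Submodule.topologicalClosure_minimal _ (Submodule.span_le.2 ?_)
      ((NonUnitalStarAlgebra.elemental.isClosed ℂ _).preimage (continuous_id.mul continuous_const))
    rintro x ⟨i, hx⟩
    exact hx.mul_defect_mem
  exact hle (hM _ (hsub j _ (.base _ (defect_mem_elemental j))))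

theorem quasispectrum_uPrime_subset (j : ι) :
    quasispectrum ℂ (uPrime A B j) ⊆ insert 0 (Metric.sphere (0 : ℂ) 1) := by
  have hT := tGen_relations A B
  have hn : IsStarNormal (uPrime A B j) := isStarNormal_uPrime j
  have h1 : uPrime A B j * star (uPrime A B j) * uPrime A B j = uPrime A B j := by
    rw [uPrime_mul_star_uPrime, uPrime_eq, hT.u_commute_defect, ← mul_assoc,
      (hT.defect_isStarProjection j).isIdempotentElem.eq]
  have h2 : cfcₙ (fun z : ℂ => z * star z * z) (uPrime A B j) =
      cfcₙ (id : ℂ → ℂ) (uPrime A B j) := by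
    rw [cfcₙ_mul (fun z : ℂ => z * star z) (fun z => z) (uPrime A B j),
      cfcₙ_mul (fun z : ℂ => z) (fun z => star z) (uPrime A B j),
      cfcₙ_star_id (R := ℂ) (uPrime A B j), cfcₙ_id' ℂ (uPrime A B j),
      cfcₙ_id ℂ (uPrime A B j), h1]
  have h3 := eqOn_of_cfcₙ_eq_cfcₙ h2
  intro z hz
  have h4 : z * star z * z = z := h3 hz
  rw [Set.mem_insert_iff, mem_sphere_zero_iff_norm]
  by_cases hz0 : z = 0
  · exact Or.inl hz0
  · right
    have h5 : z * star z = 1 := mul_right_cancel₀ hz0 (by rw [h4, one_mul])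
    have h6 := congrArg norm h5
    rw [norm_mul, norm_star, norm_one] at h6
    nlinarith [norm_nonneg z]

/-- If the spectrum of `φ u_j'` contains the circle, it is all of the spectrum of `u_j'`, and then
`φ` is isometric on the C*-algebra generated by `u_j'`. -/
theorem eq_zero_of_mem_elemental {C : Type*} [NonUnitalCStarAlgebra C]
    (φ : TAlg A B →⋆ₙₐ[ℂ] C) {j : ι}
    (hφ : Metric.sphere (0 : ℂ) 1 ⊆ quasispectrum ℂ (φ (uPrime A B j))) {x : TAlg A B}
    (hx : x ∈ NonUnitalStarAlgebra.elemental ℂ (uPrime A B j)) (h0 : φ x = 0) : x = 0 := by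
  have hn : IsStarNormal (uPrime A B j) := isStarNormal_uPrime j
  have hle := quasispectrum_uPrime_subset (A := A) (B := B) j
  have hx' : x ∈ Set.range (cfcₙ (R := ℂ) · (uPrime A B j)) := by
    rw [range_cfcₙ ℂ hn]; exact hx
  obtain ⟨g, hg⟩ := hx'
  change cfcₙ g (uPrime A B j) = x at hg
  by_cases hgc : ContinuousOn g (quasispectrum ℂ (uPrime A B j))
  swap
  · rw [← hg, cfcₙ_apply_of_not_continuousOn _ hgc]
  by_cases hg0 : g 0 = 0
  swap
  · rw [← hg, cfcₙ_apply_of_not_map_zero _ hg0]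
  have hsub : quasispectrum ℂ (uPrime A B j) ⊆ quasispectrum ℂ (φ (uPrime A B j)) := by
    intro z hz
    rcases hle hz with rfl | hz'
    · exact quasispectrum.zero_mem ℂ _
    · exact hφ hz'
  have heq : quasispectrum ℂ (φ (uPrime A B j)) = quasispectrum ℂ (uPrime A B j) :=
    (NonUnitalAlgHom.quasispectrum_apply_subset φ _).antisymm hsub
  have h1 : cfcₙ g (φ (uPrime A B j)) = cfcₙ (0 : ℂ → ℂ) (φ (uPrime A B j)) := by
    rw [← NonUnitalStarAlgHom.map_cfcₙ φ g _ hgc hg0 (UniversalCStar.continuous_hom φ) hn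
      (hn.map φ), hg, h0, cfcₙ_zero]
  have h2 := eqOn_of_cfcₙ_eq_cfcₙ h1 (hn.map φ) (by rwa [heq]) hg0 continuousOn_const rfl
  rw [heq] at h2
  rw [← hg, cfcₙ_congr h2, cfcₙ_zero]

/-- For `x` in the kernel of `φ`, the element `(x p')* (x p')` lies in the corner at the defect
projection `p'`, on which `φ` is injective; so the kernel annihilates the defect projections. -/
theorem injective_of_sphere_subset {C : Type*} [NonUnitalCStarAlgebra C]
    (φ : TAlg A B →⋆ₙₐ[ℂ] C)
    (hφ : ∀ j, Metric.sphere (0 : ℂ) 1 ⊆ quasispectrum ℂ (φ (uPrime A B j))) :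
    Function.Injective φ := by
  have hT := tGen_relations A B
  rw [← TwoSidedIdeal.ker_eq_bot]
  refine eq_bot_of_mul_defect_eq_zero _ fun x hx j => ?_
  rw [TwoSidedIdeal.mem_ker] at hx
  rw [← CStarRing.star_mul_self_eq_zero_iff]
  refine eq_zero_of_mem_elemental φ (hφ j) ?_ ?_
  · have := defect_mul_mul_defect_mem j (star x * x)
    rwa [star_mul, hT.star_defect, mul_assoc, ← mul_assoc (star x), ← mul_assoc]
  · rw [map_mul, map_mul φ x, hx, zero_mul, mul_zero]

theorem defect_mem_idealJ (j : ι) : defect A (tGen A B) j ∈ idealJ A B := by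
  rw [idealJ, TwoSidedIdeal.mem_ker, defect, map_sub, map_rowSum]
  simp only [toO_gen]
  rw [← (oGen_relations A B).rowSum_eq, sub_self]

/-- The defect projections lie in `𝒥_{A,B}`, so an ideal that meets it trivially annihilates
them. -/
theorem isEssentialIdeal_idealJ : IsEssentialIdeal (idealJ A B) := by
  intro I _ hI
  refine eq_bot_of_mul_defect_eq_zero I fun x hx j => ?_
  rw [← TwoSidedIdeal.mem_bot, ← hI, TwoSidedIdeal.mem_inf]
  exact ⟨I.mul_mem_right _ _ hx, (idealJ A B).mul_mem_left _ _ (defect_mem_idealJ j)⟩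

end Corner

end Katsura

/-! ### The Fock representation -/

section Restrict

variable {X : Type*}

open Classical in
/-- The restriction of an injective map `g : X → X` to a set `s`, as a partial bijection of `X`. -/
noncomputable def PEquiv.restrict (g : X → X) (hg : Function.Injective g) (s : Set X) : X ≃. X where
  toFun x := if x ∈ s then some (g x) else none
  invFun y := if h : ∃ x ∈ s, g x = y then some h.choose else none
  inv x y := by
    constructor
    · intro h
      split_ifs at h with h'
      obtain ⟨h1, h2⟩ := h'.choose_spec
      rw [Option.some.inj h] at h1 h2
      rw [if_pos h1, h2]
    · intro h
      split_ifs at h with hx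
      have h' : ∃ z ∈ s, g z = y := ⟨x, hx, Option.some.inj h⟩
      rw [dif_pos h', hg (h'.choose_spec.2.trans (Option.some.inj h).symm)]

namespace PEquiv

variable {g g' : X → X} {hg : Function.Injective g} {hg' : Function.Injective g'} {s s' : Set X}

theorem mem_restrict {x y : X} : y ∈ restrict g hg s x ↔ x ∈ s ∧ g x = y := by
  classical
  change (if x ∈ s then some (g x) else none) = some y ↔ _
  split_ifs with h <;> simp [h]

theorem mem_restrict_symm {x y : X} : y ∈ (restrict g hg s).symm x ↔ y ∈ s ∧ g y = x := by
  rw [← mem_restrict (hg := hg)]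
  exact mem_iff_mem _

theorem restrict_trans_restrict (h : ∀ x ∈ s, g x ∈ s') :
    (restrict g hg s).trans (restrict g' hg' s') =
      restrict (g' ∘ g) (hg'.comp hg) s := by
  ext x y
  simp only [← Option.mem_def, mem_trans, mem_restrict, Function.comp]
  constructor
  · rintro ⟨z, ⟨hx, rfl⟩, -, rfl⟩; exact ⟨hx, rfl⟩
  · rintro ⟨hx, rfl⟩; exact ⟨g x, ⟨hx, rfl⟩, h x hx, rfl⟩

theorem restrict_trans_symm :
    (restrict g hg s).trans (restrict g hg s).symm = restrict id Function.injective_id s := by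
  ext x y
  simp only [← Option.mem_def, mem_trans, mem_restrict, mem_restrict_symm, id]
  constructor
  · rintro ⟨z, ⟨hx, rfl⟩, -, h⟩; exact ⟨hx, (hg h).symm⟩
  · rintro ⟨hx, rfl⟩; exact ⟨g x, ⟨hx, rfl⟩, hx, rfl⟩

theorem restrict_symm_trans (h : ∀ y, y ∈ s' ↔ ∃ x ∈ s, g x = y) :
    (restrict g hg s).symm.trans (restrict g hg s) = restrict id Function.injective_id s' := by
  ext x y
  simp only [← Option.mem_def, mem_trans, mem_restrict, mem_restrict_symm, id, h]
  constructor
  · rintro ⟨z, ⟨hz, rfl⟩, -, rfl⟩; exact ⟨⟨z, hz, rfl⟩, rfl⟩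
  · rintro ⟨⟨z, hz, rfl⟩, rfl⟩; exact ⟨z, ⟨hz, rfl⟩, hz, rfl⟩

theorem restrict_trans_restrict_symm_eq_bot (h : ∀ x ∈ s, ∀ y ∈ s', g x ≠ g' y) :
    (restrict g hg s).trans (restrict g' hg' s').symm = ⊥ := by
  ext x y
  simp only [← Option.mem_def, mem_trans, mem_restrict, mem_restrict_symm]
  constructor
  · rintro ⟨z, ⟨hx, rfl⟩, hy, h'⟩; exact absurd h'.symm (h x hx y hy)
  · intro h; exact absurd h (by simp)

theorem restrict_id_symm :
    (restrict id Function.injective_id s).symm = restrict id Function.injective_id s := by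
  ext x y
  simp only [← Option.mem_def, mem_restrict, mem_restrict_symm, id]
  constructor <;> rintro ⟨h, rfl⟩ <;> exact ⟨h, rfl⟩

theorem restrict_congr (h : ∀ x ∈ s, g x = g' x) : restrict g hg s = restrict g' hg' s := by
  ext x y
  simp only [← Option.mem_def, mem_restrict]
  exact and_congr_right fun hx => by rw [h x hx]

end PEquiv

end Restrict

namespace Katsura

/-- The index set of the orthonormal basis of the Fock space. The element `vac i k` stands for
`u_i^k` applied to the vacuum vector at `i`, and `cons i j n x` with `0 ≤ n < A i j` for
`s_{i,j,n}` applied to `x`. The elements for which `n` is not in this range, or for which `x` does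
not start at `j`, play no role, but do no harm. -/
inductive FockIndex (ι : Type u) : Type u
  | vac (i : ι) (k : ℤ) : FockIndex ι
  | cons (i j : ι) (n : ℤ) (x : FockIndex ι) : FockIndex ι

namespace FockIndex

variable {ι : Type u}

/-- The initial vertex. -/
def start : FockIndex ι → ι
  | vac i _ => i
  | cons i _ _ _ => i

variable (A B : ι → ι →₀ ℤ)

open Classical in
/-- The action of the `m`-th power of `u_i`: on `s_{i,j,n} x` it is the odometer
`u_i^m s_{i,j,n} = s_{i,j,n + m B} = s_{i,j,r} u_j^q`, where `n + m B = r + q A` with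
`0 ≤ r < A`. -/
noncomputable def act : FockIndex ι → ℤ → FockIndex ι
  | vac i k, m => vac i (k + m)
  | cons i j n x, m =>
    if 0 ≤ n ∧ n < A i j then
      cons i j ((n + m * B i j) % A i j) (act x ((n + m * B i j) / A i j))
    else cons i j n x

/-- The action of `s_{i,j,n}`. -/
noncomputable def ins (i j : ι) (n : ℤ) (x : FockIndex ι) : FockIndex ι :=
  cons i j (n % A i j) (act A B x (n / A i j))

theorem start_act (x : FockIndex ι) (m : ℤ) : (act A B x m).start = x.start := by
  cases x with
  | vac => rfl
  | cons => rw [act]; split_ifs <;> rfl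

theorem act_zero (x : FockIndex ι) : act A B x 0 = x := by
  induction x with
  | vac i k => rw [act, add_zero]
  | cons i j n x ih =>
    rw [act]
    split_ifs with h
    · rw [zero_mul, add_zero, Int.emod_eq_of_lt h.1 h.2, Int.ediv_eq_zero_of_lt h.1 h.2, ih]
    · rfl

theorem act_act (x : FockIndex ι) (m l : ℤ) : act A B (act A B x m) l = act A B x (m + l) := by
  induction x generalizing m l with
  | vac i k => simp only [act, add_assoc]
  | cons i j n x ih =>
    by_cases h : 0 ≤ n ∧ n < A i j
    · have ha : 0 < A i j := by omega
      have h' : 0 ≤ (n + m * B i j) % A i j ∧ (n + m * B i j) % A i j < A i j :=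
        ⟨Int.emod_nonneg _ ha.ne', Int.emod_lt_of_pos _ ha⟩
      have e : n + (m + l) * B i j = (n + m * B i j) % A i j + l * B i j +
          A i j * ((n + m * B i j) / A i j) := by
        have := Int.emod_add_mul_ediv (n + m * B i j) (A i j)
        linarith [add_mul m l (B i j)]
      rw [act, if_pos h, act, if_pos h', act, if_pos h, ih, e, Int.add_mul_emod_self_left,
        Int.add_mul_ediv_left _ _ ha.ne', add_comm (_ / _) (_ / _)]
    · rw [act, if_neg h, act, if_neg h, act, if_neg h]

theorem act_injective (m : ℤ) : Function.Injective fun x => act A B x m := by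
  intro x y h
  have h' := congrArg (fun z => act A B z (-m)) h
  simpa only [act_act, add_neg_cancel, act_zero] using h'

theorem ins_injective (i j : ι) (n : ℤ) : Function.Injective (ins A B i j n) := by
  intro x y h
  simp only [ins, cons.injEq, true_and] at h
  exact act_injective A B _ h

variable {A} in
theorem ins_act {i j : ι} (hij : 1 ≤ A i j) (n : ℤ) (x : FockIndex ι) :
    ins A B i j n (act A B x 1) = ins A B i j (n + A i j) x := by
  have ha : A i j ≠ 0 := by omega
  rw [ins, ins, act_act, Int.add_emod_right, Int.add_ediv_of_dvd_right (dvd_refl _),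
    Int.ediv_self ha, add_comm]

variable {A} in
theorem act_ins {i j : ι} (hij : 1 ≤ A i j) (n : ℤ) (x : FockIndex ι) :
    act A B (ins A B i j n x) 1 = ins A B i j (n + B i j) x := by
  have ha : 0 < A i j := by omega
  have h' : 0 ≤ n % A i j ∧ n % A i j < A i j :=
    ⟨Int.emod_nonneg _ ha.ne', Int.emod_lt_of_pos _ ha⟩
  have e : n + B i j = n % A i j + 1 * B i j + A i j * (n / A i j) := by
    linarith [Int.emod_add_mul_ediv n (A i j)]
  rw [ins, act, if_pos h', ins, act_act, e, Int.add_mul_emod_self_left,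
        Int.add_mul_ediv_left _ _ ha.ne', add_comm (_ / _) (_ / _)]

end FockIndex

open FockIndex

variable {ι : Type u} (A B : ι → ι →₀ ℤ)

/-- The partial bijections by which the generators act on the basis of the Fock space. -/
noncomputable def fockMap : Gen A → (FockIndex ι ≃. FockIndex ι)
  | .p i => PEquiv.restrict id Function.injective_id {x | x.start = i}
  | .u i => PEquiv.restrict (fun x => act A B x 1) (act_injective A B 1) {x | x.start = i}
  | .s i j _ n => PEquiv.restrict (ins A B i j n) (ins_injective A B i j n) {x | x.start = j}

/-- The generators of `𝒯_{A,B}` on the Fock space. -/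
noncomputable def fockFamily (g : Gen A) :
    lp (fun _ : FockIndex ι => ℂ) 2 →L[ℂ] lp (fun _ : FockIndex ι => ℂ) 2 :=
  tensorOp (fockMap A B g) 1

theorem fockFamily_relations : ToeplitzRelations A B (fockFamily A B) := by
  have hb : BaseRelations A B (fockFamily A B) :=
    { isStarProjection := fun i =>
        { isIdempotentElem := by
            rw [IsIdempotentElem, fockFamily, tensorOp_mul, mul_one, fockMap,
              PEquiv.restrict_trans_restrict]
            · rfl
            · exact fun x hx => hx
          isSelfAdjoint := by
            rw [IsSelfAdjoint, fockFamily, star_tensorOp, star_one, fockMap,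
              PEquiv.restrict_id_symm] }
      orthogonal := fun i j hij => by
        rw [fockFamily, fockFamily, tensorOp_mul, mul_one, fockMap, fockMap]
        rw [← PEquiv.restrict_id_symm (s := {x : FockIndex ι | x.start = i}),
          PEquiv.restrict_trans_restrict_symm_eq_bot, tensorOp_bot]
        rintro x rfl y rfl h
        exact hij (congrArg start h.symm)
      star_u_mul_u := fun i => by
        rw [fockFamily, fockFamily, star_tensorOp, star_one, tensorOp_mul, mul_one, fockMap,
          fockMap, PEquiv.restrict_trans_symm]
      u_mul_star_u := fun i => by
        rw [fockFamily, fockFamily, star_tensorOp, star_one, tensorOp_mul, mul_one, fockMap,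
          fockMap, PEquiv.restrict_symm_trans]
        intro y
        constructor
        · rintro rfl
          exact ⟨act A B y (-1), start_act A B y _, by
            rw [act_act, neg_add_cancel, act_zero]⟩
        · rintro ⟨x, rfl, rfl⟩
          exact start_act A B x 1
      partialIsometry := fun i j hij n => by
        rw [fockFamily, star_tensorOp, star_one, tensorOp_mul, tensorOp_mul, mul_one, mul_one,
          ← PEquiv.trans_assoc, fockMap, PEquiv.restrict_trans_symm,
          PEquiv.restrict_trans_restrict]
        · rfl
        · exact fun x hx => hx
      s_mul_u := fun i j hij n => by
        rw [fockFamily, fockFamily, fockFamily, tensorOp_mul, mul_one, fockMap, fockMap, fockMap,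
          PEquiv.restrict_trans_restrict]
        · congr 1
          exact PEquiv.restrict_congr fun x _ => ins_act B hij n x
        · exact fun x hx => (start_act A B x 1).trans hx
      u_mul_s := fun i j hij n => by
        rw [fockFamily, fockFamily, fockFamily, tensorOp_mul, mul_one, fockMap, fockMap, fockMap,
          PEquiv.restrict_trans_restrict]
        · congr 1
          exact PEquiv.restrict_congr fun x _ => act_ins B hij n x
        · exact fun x hx => rfl
      star_s_mul_s := fun i j hij n => by
        rw [fockFamily, fockFamily, star_tensorOp, star_one, tensorOp_mul, mul_one, fockMap,
          fockMap, PEquiv.restrict_trans_symm] }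
  refine hb.toeplitz fun i j k hij hik n hn m hm hne => ?_
  rw [fockFamily, fockFamily, star_tensorOp, star_one, tensorOp_mul, mul_one, fockMap,
    fockMap, PEquiv.restrict_trans_restrict_symm_eq_bot, tensorOp_bot]
  intro x _ y _ h
  simp only [ins, cons.injEq, true_and] at h
  obtain ⟨rfl, h, -⟩ := h
  rw [Finset.mem_Icc] at hn hm
  -- Both `n` and `m` lie in `{1, …, A i k}` and they are congruent modulo `A i k`.
  have h1 : A i k ∣ m - n := (Int.emod_eq_emod_iff_emod_sub_eq_zero.1 h |> Int.dvd_of_emod_eq_zero)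
  have h2 := Int.eq_zero_of_abs_lt_dvd h1 (by rw [abs_lt]; omega)
  exact hne rfl (by omega)

theorem fockFamily_u_apply_vac (v : lp (fun _ : FockIndex ι => ℂ) 2) (i : ι) (k : ℤ) :
    fockFamily A B (.u i) v (.vac i k) = v (.vac i (k - 1)) := by
  have h : (fockMap A B (.u i)).symm (.vac i k) = some (.vac i (k - 1)) := by
    rw [fockMap, ← Option.mem_def, PEquiv.mem_restrict_symm]
    refine ⟨rfl, ?_⟩
    rw [act, sub_add_cancel]
  rw [fockFamily, tensorOp_apply, h]
  rfl

theorem fockFamily_s_apply_vac (v : lp (fun _ : FockIndex ι => ℂ) 2) (i j : ι) (hij : 1 ≤ A i j)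
    (n : ℤ) (k : ℤ) : fockFamily A B (.s i j hij n) v (.vac i k) = 0 := by
  have h : (fockMap A B (.s i j hij n)).symm (.vac i k) = none := by
    rw [Option.eq_none_iff_forall_not_mem]
    intro y hy
    rw [fockMap, PEquiv.mem_restrict_symm] at hy
    exact absurd hy.2 (by simp [ins])
  rw [fockFamily, tensorOp_apply, h]
  rfl

/-- On the vacuum vectors at `i`, the image of `u_i'` is the bilateral shift. -/
theorem uPrime_apply_vac
    (Φ : TAlg A B →⋆ₙₐ[ℂ] (lp (fun _ : FockIndex ι => ℂ) 2 →L[ℂ] lp (fun _ : FockIndex ι => ℂ) 2))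
    (hΦ : ∀ g, Φ (tGen A B g) = fockFamily A B g) (v : lp (fun _ : FockIndex ι => ℂ) 2) (i : ι)
    (k : ℤ) : Φ (uPrime A B i) v (.vac i k) = v (.vac i (k - 1)) := by
  rw [uPrime, map_sub, map_rowSum]
  simp only [hΦ]
  change fockFamily A B (.u i) v (.vac i k) - rowSum A (fockFamily A B) i (B i) v (.vac i k) = _
  rw [fockFamily_u_apply_vac, sub_eq_self, rowSum]
  simp only [_root_.sum_apply, lp.coeFn_sum, Finset.sum_apply]
  refine Finset.sum_eq_zero fun j _ => Finset.sum_eq_zero fun n _ => ?_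
  exact fockFamily_s_apply_vac A B _ _ _ _ _ _

/-- A square-summable solution of `w (k - 1) - z w k = δ_{k,0}` with `|z| = 1` has constant
absolute value on each side of zero, and hence vanishes: so there is none. -/
theorem not_exists_resolvent_solution {z : ℂ} (hz : ‖z‖ = 1) (w : ℤ → ℂ)
    (hw : Filter.Tendsto w Filter.cofinite (nhds 0))
    (h0 : w (-1) - z * w 0 = 1) (h : ∀ k ≠ 0, w (k - 1) = z * w k) : False := by
  have hn : ∀ k ≠ 0, ‖w (k - 1)‖ = ‖w k‖ := fun k hk => by rw [h k hk, norm_mul, hz, one_mul]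
  have key : ∀ (e : ℕ → ℤ), Function.Injective e → (∀ n, ‖w (e n)‖ = ‖w (e 0)‖) → w (e 0) = 0 := by
    intro e he hc
    have h1 := (hw.comp he.tendsto_cofinite).norm
    rw [Nat.cofinite_eq_atTop] at h1
    simp only [Function.comp, hc, norm_zero] at h1
    exact norm_eq_zero.1 (tendsto_nhds_unique tendsto_const_nhds h1)
  have h1 : w 0 = 0 := by
    refine key (fun n => (n : ℤ)) Nat.cast_injective fun n => ?_
    induction n with
    | zero => rfl
    | succ n ih =>
      rw [← ih, ← hn _ (by omega)]
      congr 2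
      push_cast; ring
  have h2 : w (-1) = 0 := by
    refine key (fun n => -1 - (n : ℤ)) (fun a b hab => by simpa using hab) fun n => ?_
    induction n with
    | zero => rfl
    | succ n ih =>
      rw [← ih, ← hn (-1 - (n : ℤ)) (by omega)]
      congr 2
      push_cast; ring
  rw [h1, h2] at h0
  simp at h0

/-- No resolvent of the bilateral shift exists at a point of the circle: it would map the vacuum
vector to a square-summable solution of the eigenvalue equation with a source at zero. -/
theorem sphere_subset_quasispectrum_uPrime (i : ι) :
    Metric.sphere (0 : ℂ) 1 ⊆ quasispectrum ℂ (uPrime A B i) := by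
  classical
  intro z hz
  rw [mem_sphere_zero_iff_norm] at hz
  obtain ⟨Φ, hΦ, -⟩ := TAlg.existsUnique_hom A B _ (fockFamily_relations A B)
  refine NonUnitalAlgHom.quasispectrum_apply_subset Φ _ ?_
  rw [quasispectrum_eq_spectrum_union_zero]
  left
  rw [spectrum.mem_iff]
  rintro ⟨y, hy⟩
  set δ : lp (fun _ : FockIndex ι => ℂ) 2 := lp.single 2 (FockIndex.vac i 0) (1 : ℂ) with hδ
  set v := -(y⁻¹.1 δ) with hv
  have h1 : Φ (uPrime A B i) v - z • v = δ := by
    have h2 : (y.1 * y⁻¹.1) δ = δ := by rw [Units.mul_inv]; rfl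
    have h3 : y.1 (y⁻¹.1 δ) = δ := h2
    rw [hy, Algebra.algebraMap_eq_smul_one] at h3
    change z • (y⁻¹.1 δ) - Φ (uPrime A B i) (y⁻¹.1 δ) = δ at h3
    rw [hv, map_neg, smul_neg, sub_neg_eq_add, neg_add_eq_sub]
    exact h3
  have h2 : ∀ k : ℤ, v (.vac i (k - 1)) - z * v (.vac i k) = δ (.vac i k) := by
    intro k
    rw [← uPrime_apply_vac A B Φ hΦ, ← h1]
    rfl
  have hvac : Function.Injective fun k : ℤ => FockIndex.vac i k := fun a b h => by simpa using h
  have hv0 : Filter.Tendsto (fun x => v x) Filter.cofinite (nhds 0) := by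
    have h3 := (lp.memℓp v).summable (by norm_num)
    have h4 := h3.tendsto_cofinite_zero
    simp only [ENNReal.toReal_ofNat, Real.rpow_ofNat] at h4
    rw [tendsto_zero_iff_norm_tendsto_zero]
    have h5 := (Real.continuous_sqrt.tendsto 0).comp h4
    rw [Real.sqrt_zero] at h5
    exact h5.congr fun x => Real.sqrt_sq (norm_nonneg _)
  refine not_exists_resolvent_solution hz (fun k => v (.vac i k)) (hv0.comp hvac.tendsto_cofinite)
    ?_ fun k hk => ?_
  · have := h2 0
    rw [zero_sub] at this
    rw [this, hδ]
    simp
  · have h3 : δ (.vac i k) = 0 := by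
      rw [hδ]
      exact lp.single_apply_ne (E := fun _ : FockIndex ι => ℂ) 2 _ _ (fun h => hk (hvac h))
    rw [← sub_eq_zero, h2 k, h3]

/-- A continuous function which is nonzero at `z` and vanishes on the quasispectrum of `φ a` gives
an element of the kernel of `φ`. -/
theorem quasispectrum_subset_of_injective {C D : Type*} [NonUnitalCStarAlgebra C]
    [NonUnitalCStarAlgebra D] (φ : C →⋆ₙₐ[ℂ] D) (hφ : Function.Injective φ) {a : C}
    (ha : IsStarNormal a) : quasispectrum ℂ a ⊆ quasispectrum ℂ (φ a) := by
  intro z hz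
  by_contra hz'
  have hcl : IsClosed (quasispectrum ℂ (φ a)) := (quasispectrum.isCompact (𝕜 := ℂ) (φ a)).isClosed
  let g : ℂ → ℂ := fun w => (Metric.infDist w (quasispectrum ℂ (φ a)) : ℂ)
  have hg : Continuous g := Complex.continuous_ofReal.comp (Metric.continuous_infDist_pt _)
  have hvan : ∀ w ∈ quasispectrum ℂ (φ a), g w = 0 := fun w hw => by
    simp only [g, Metric.infDist_zero_of_mem hw, Complex.ofReal_zero]
  have hg0 : g 0 = 0 := hvan 0 (quasispectrum.zero_mem ℂ _)
  have h1 : cfcₙ g (φ a) = 0 := by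
    rw [cfcₙ_congr (g := (0 : ℂ → ℂ)) hvan, cfcₙ_zero]
  rw [← NonUnitalStarAlgHom.map_cfcₙ φ g a hg.continuousOn hg0 (UniversalCStar.continuous_hom φ) ha
    (ha.map φ)] at h1
  have h2 : cfcₙ g a = cfcₙ (0 : ℂ → ℂ) a := by
    rw [cfcₙ_zero]; exact hφ (by rw [h1, map_zero])
  have h3 : g z = 0 :=
    eqOn_of_cfcₙ_eq_cfcₙ h2 ha hg.continuousOn hg0 continuousOn_const rfl hz
  rw [Complex.ofReal_eq_zero] at h3
  exact hz' ((hcl.mem_iff_infDist_zero ⟨0, quasispectrum.zero_mem ℂ _⟩).2 h3)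

end Katsura

theorem propositionA1 {ι : Type u} [Countable ι] [Nonempty ι] (A B : ι → ι →₀ ℤ)
    (hAB : Katsura.StandingCondition A B) :
    IsEssentialIdeal (Katsura.idealJ A B) ∧
      ∀ (C : Type v) [NonUnitalCStarAlgebra C] (φ : Katsura.TAlg A B →⋆ₙₐ[ℂ] C),
        Function.Injective φ ↔
          ∀ i : ι, Metric.sphere (0 : ℂ) 1 ⊆ quasispectrum ℂ (φ (Katsura.uPrime A B i)) :=
  ⟨Katsura.isEssentialIdeal_idealJ, fun _ _ φ =>
    ⟨fun hφ i => (Katsura.sphere_subset_quasispectrum_uPrime A B i).trans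
        (Katsura.quasispectrum_subset_of_injective φ hφ (Katsura.isStarNormal_uPrime i)),
      Katsura.injective_of_sphere_subset φ⟩⟩
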